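/- **Theorem 1.2 (Perturbation of Heaviside).** *Kernel.* Let $K:\mathbb{R}\to\mathbb{R}$ be an even, continuous, integrable function, smooth on $\mathbb{R}\setminus\{0\}$, whose first and second classical derivatives on $\mathbb{R}\setminus\{0\}$ are integrable, with $\int_{-\infty}^0K=\int_0^\infty K=\tfrac12$ and $|K(x)|\le Ce^{-\rho|x|}$ for some constants $C$ and $\rho>0$, and such that for some $M>0$ we have $K>0$ on $(-M,M)$ and $K<0$ on $(-\infty,-M)\cup(M,\infty)$. Let $0<\theta<\tfrac12$. *Firing rates.* Let $\{S_\tau\}_{\tau\ge0}$ be functions on $\mathbb{R}$ such that $S_0$ is the Heaviside function ($0$ on $(-\infty,0)$, $1$ on $(0,\infty)$, with any value at $0$); for each $\tau>0$, $S_\tau$ is continuous, $S_\tau=0$ on $(-\infty,0]$, $S_\tau=1$ on $[\tau,\infty)$, and $S_\tau$ is smooth on $(0,\tau)$ and nondecreasing on $[0,\tau]$; and $\|S_\tau-S_{\tau'}\|_{L^1(\mathbb{R})}\to0$ as $\tau\to\tau'$, $\tau\ge 0$, for each $\tau'\ge0$. *Heaviside front.* Let $\mu_0>0$ and let $U_0:\mathbb{R}\to\mathbb{R}$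 be differentiable with $$\mu_0U_0'(z)+U_0(z)=\int_{\mathbb{R}}K(z-y)S_0(U_0(y)-\theta)\,dy\qquad(z\in\mathbb{R}),$$ $U_0(0)=\theta$, $U_0'(0)>0$, $U_0<\theta$ on $(-\infty,0)$, $U_0>\theta$ on $(0,\infty)$, $U_0(-\infty)=0$, $U_0(\infty)=1$, $U_0'(\pm\infty)=0$. *Hypothesis $H_1(\theta,\tau)$.* A differentiable $U:\mathbb{R}\to\mathbb{R}$ satisfies $H_1(\theta,\tau)$, where $\tau\ge 0$, if $\theta+\tau<1$; for every $v\in[\theta,\theta+\tau]$ there is a point $z$ with $U(z)=v$, $U<v$ on $(-\infty,z)$ and $U>v$ on $(z,\infty)$; $U'(z)>0$ whenever $U(z)\in[\theta,\theta+\tau]$; and $U^{-1}(\theta+\tau)-U^{-1}(\theta)\le\min\{\sigma_1,\sigma_2,\sigma_3\}$, where $\sigma_1,\sigma_2,\sigma_3$ are the unique positive solutions (whose existence and uniqueness are part of the claim) of $$\int_{-\infty}^{-\sigma_1}K=\int_{\sigma_1}^\infty K=0,\qquad \int_{-\infty}^{-M-\sigma_2}K+\int_{-M}^{-M+\sigma_2}K=\theta,\qquad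 \int_{-\infty}^{M-\sigma_3}K+\int_{M}^{M+\sigma_3}K=\theta+\tau.$$ *Conclusion.* There are $\varepsilon_0>0$ and a family of pairs $(U_\tau,\mu_\tau)$, $\tau\in[0,\varepsilon_0)$, which at $\tau=0$ is the given pair $(U_0,\mu_0)$, such that for every $\tau\in[0,\varepsilon_0)$: $U_\tau\in C^2(\mathbb{R})$, $\mu_\tau>0$, $$\mu_\tau U_\tau'(z)+U_\tau(z)=\int_{\mathbb{R}}K(z-y)S_\tau(U_\tau(y)-\theta)\,dy\qquad(z\in\mathbb{R});$$ every translate of $U_\tau$ solves the same equation; $u(x,t)=U_\tau(x+\mu_\tau t)$ solves $u_t+u=\int_{\mathbb{R}}K(x-y)S_\tau(u(y,t)-\theta)\,dy$ for all real $x,t$; $U_\tau$ satisfies $H_1(\theta,\tau)$; and $$\lim_{z\to-\infty}U_\tau(z)=0,\quad\lim_{z\to\infty}U_\tau(z)=1,\quad\lim_{z\to\pm\infty}U_\tau'(z)=\lim_{z\to\pm\infty}U_\tau''(z)=0.$$ -/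

import Mathlib

open MeasureTheory Filter Topology Set
open scoped ContDiff

/-- Lateral inhibition ("Mexican hat") kernels `K`, positive on `(-M, M)` and negative outside
`[-M, M]`.  The last two integrability fields say that the first and second derivatives of `K`,
which exist classically off the origin, are in `L¹`; the values of `deriv` at the single point
`0` are irrelevant for them.  Every such `K` in `W^{2,1}(ℝ)` is covered, and so are kernels with a
corner at the origin, such as `A e^{-a|x|} - B e^{-b|x|}`. -/
structure IsLateralInhibitionKernel (K : ℝ → ℝ) (M : ℝ) : Prop where
  continuous : Continuous K
  smooth_off_zero : ContDiffOn ℝ ∞ K {0}ᶜ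
  integrable : Integrable K
  integrable_deriv : Integrable (deriv K)
  integrable_deriv_deriv : Integrable (deriv (deriv K))
  symmetric : ∀ x, K (-x) = K x
  integral_left : ∫ x in Iic (0 : ℝ), K x = 1 / 2
  integral_right : ∫ x in Ioi (0 : ℝ), K x = 1 / 2
  exp_bound : ∃ C ρ : ℝ, 0 < ρ ∧ ∀ x, |K x| ≤ C * Real.exp (-ρ * |x|)
  M_pos : 0 < M
  pos_inside : ∀ x, |x| < M → 0 < K x
  neg_outside : ∀ x, M < |x| → K x < 0

/-- A family `{S τ}`, `τ ≥ 0`, of smoothed Heaviside functions: for `τ > 0` the function `S τ`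
vanishes on `(-∞, 0]`, equals `1` on `[τ, ∞)`, and in between it is a smooth increasing function
with the boundary values `0` and `1`; `S 0` is the Heaviside function (with any value at the
jump); and `τ ↦ S τ` is continuous for the `L¹` norm on `[0, ∞)`.  Members with `τ < 0` play no
role. -/
structure IsSmoothHeavisideFamily (S : ℝ → ℝ → ℝ) : Prop where
  heaviside_neg : ∀ u, u < 0 → S 0 u = 0
  heaviside_pos : ∀ u, 0 < u → S 0 u = 1
  eq_zero : ∀ τ, 0 < τ → ∀ u, u ≤ 0 → S τ u = 0
  eq_one : ∀ τ, 0 < τ → ∀ u, τ ≤ u → S τ u = 1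
  continuous : ∀ τ, 0 < τ → Continuous (S τ)
  smooth : ∀ τ, 0 < τ → ContDiffOn ℝ ∞ (S τ) (Ioo 0 τ)
  increasing : ∀ τ, 0 < τ → MonotoneOn (S τ) (Icc 0 τ)
  continuous_L1 : ∀ τ₀, 0 ≤ τ₀ →
    Tendsto (fun τ => eLpNorm (S τ - S τ₀) 1 volume) (𝓝[Ici 0] τ₀) (𝓝 0)

/-- The profile equation `μ U' + U = ∫ K(z - y) S(U(y) - θ) dy`. -/
def SolvesFrontEq (K S : ℝ → ℝ) (θ μ : ℝ) (U : ℝ → ℝ) : Prop :=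
  Differentiable ℝ U ∧
    ∀ z, μ * deriv U z + U z = ∫ y, K (z - y) * S (U y - θ)

/-- The neural field equation `u_t + u = ∫ K(x - y) S(u(y,t) - θ) dy`. -/
def SolvesNeuralField (K S : ℝ → ℝ) (θ : ℝ) (u : ℝ → ℝ → ℝ) : Prop :=
  ∀ x t, HasDerivAt (fun s => u x s) (-(u x t) + ∫ y, K (x - y) * S (u y t - θ)) t

/-- `(U, μ)` is a front with positive speed for the (Heaviside) firing rate `S`, crossing the
threshold `θ` exactly once, at `0`. -/
structure IsHeavisideFront (K S : ℝ → ℝ) (θ : ℝ) (U : ℝ → ℝ) (μ : ℝ) : Prop where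
  speed_pos : 0 < μ
  solves : SolvesFrontEq K S θ μ U
  at_zero : U 0 = θ
  deriv_pos : 0 < deriv U 0
  below : ∀ z, z < 0 → U z < θ
  above : ∀ z, 0 < z → θ < U z
  lim_bot : Tendsto U atBot (𝓝 0)
  lim_top : Tendsto U atTop (𝓝 1)
  deriv_lim_bot : Tendsto (deriv U) atBot (𝓝 0)
  deriv_lim_top : Tendsto (deriv U) atTop (𝓝 0)

/-- `σ` is the unique positive real number with the property `P`. -/
def IsUniquePositive (P : ℝ → Prop) (σ : ℝ) : Prop :=
  0 < σ ∧ P σ ∧ ∀ s, 0 < s → P s → s = σ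

/-- The constant `σ₁` of a kernel. -/
def IsSigma1 (K : ℝ → ℝ) (σ : ℝ) : Prop :=
  IsUniquePositive (fun s => ∫ x in Iic (-s), K x = 0 ∧ ∫ x in Ioi s, K x = 0) σ

/-- The constant `σ₂(v)` of a kernel. -/
def IsSigma2 (K : ℝ → ℝ) (M v σ : ℝ) : Prop :=
  IsUniquePositive
    (fun s => (∫ x in Iic (-M - s), K x) + (∫ x in (-M)..(-M + s), K x) = v) σ

/-- The constant `σ₃(v)` of a kernel. -/
def IsSigma3 (K : ℝ → ℝ) (M v σ : ℝ) : Prop :=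
  IsUniquePositive
    (fun s => (∫ x in Iic (M - s), K x) + (∫ x in M..(M + s), K x) = v) σ

/-- `U` crosses the level `v` upwards at `z`, and takes the value `v` nowhere else. -/
def CrossesOnceAt (U : ℝ → ℝ) (v z : ℝ) : Prop :=
  U z = v ∧ (∀ y, y < z → U y < v) ∧ ∀ y, z < y → v < U y

/-- Hypothesis `H₁(θ, τ)` on a front profile `U`: each level in `[θ, θ + τ]` is crossed exactly
once, `U' > 0` wherever `U ∈ [θ, θ + τ]`, and
`U⁻¹(θ + τ) - U⁻¹(θ) ≤ min {σ₁, σ₂(θ), σ₃(θ + τ)}`. -/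
def HypothesisH1 (K : ℝ → ℝ) (M θ τ : ℝ) (U : ℝ → ℝ) : Prop :=
  θ + τ < 1 ∧
  (∀ v ∈ Icc θ (θ + τ), ∃ z, CrossesOnceAt U v z) ∧
  (∀ z, U z ∈ Icc θ (θ + τ) → 0 < deriv U z) ∧
  ∃ σ₁ σ₂ σ₃ : ℝ, IsSigma1 K σ₁ ∧ IsSigma2 K M θ σ₂ ∧ IsSigma3 K M (θ + τ) σ₃ ∧
    ∀ a b, U a = θ → U b = θ + τ → b - a ≤ min σ₁ (min σ₂ σ₃)

/-! For a fixed speed `μ`, a bounded input `g` determines the bounded solution `expAvg g μ` of `μ F'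
+ F = g`. Let `W` be the primitive of `K` vanishing at `-∞`. A profile crossing the threshold only
at `0` turns the Heaviside rate on exactly for `y > 0`, so its input is `W`, and `U₀ = expAvg W μ₀`.

For `τ > 0`, normalise `U(0) = θ` and expect slope at least `m` near `0`. Then the firing pattern is
`0` left of `0` and `1` right of `L = τ / m`, and the input is `W` minus an integral over `[0, L]`
only. The equation becomes a fixed point problem for `U` on `[0, L]`, with a correction of size
`O(τ)`.

The firing rate may be arbitrarily steep, so the superposition operator has no uniform Lipschitz
constant in the sup norm. On functions of slope at least `m`, however, a sup-norm change `ε` moves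
each level by at most `ε / m`, and composition is Lipschitz into `L¹`
(`IsRamp.integral_abs_comp_sub_le`). After subtraction of a constant forcing the value `θ` at `0`,
the map is a contraction for small `τ`, and its fixed point is continuous in `μ`. The intermediate
value theorem then picks a speed for which the subtracted constant vanishes
(`exists_profile_fixedPoint`).

The sign change it needs comes from `μ ↦ expAvg W μ 0` having negative derivative at `μ₀`
(`integral_mul_exp_mul_pos`), which rests on `θ > 0` and the single sign change of `K` on the
half-line. The slope comes from `θ < 1/2`: it is `(W 0 - θ) / μ₀` at `0`, with `W 0 = 1/2`. Finally
`U` is uniformly close to `U₀` and steep near `0`, so it crosses the levels once each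
(`hypothesisH1_of_slope`); this confirms the assumed firing pattern. -/

/-! ### Exponential averages and the linear equation `μ F' + F = g`. -/

/-- The average of `g` over the past of `z`, with exponential weights at scale `μ`: the bounded
solution of `μ F' + F = g`. -/
noncomputable def expAvg (g : ℝ → ℝ) (μ z : ℝ) : ℝ :=
  ∫ s in Ioi (0 : ℝ), Real.exp (-s) * g (z - μ * s)

theorem integrableOn_expAvg {g : ℝ → ℝ} (hg : Continuous g) {C : ℝ} (hC : ∀ x, |g x| ≤ C)
    (μ z : ℝ) : IntegrableOn (fun s : ℝ => Real.exp (-s) * g (z - μ * s)) (Ioi 0) := by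
  refine Integrable.mul_bdd (c := C) (integrableOn_exp_neg_Ioi 0) ?_ ?_
  · exact (hg.comp (by fun_prop)).aestronglyMeasurable
  · exact Eventually.of_forall fun s => hC _

theorem continuous_expAvg {g : ℝ → ℝ} (hg : Continuous g) {C : ℝ} (hC : ∀ x, |g x| ≤ C) :
    Continuous fun q : ℝ × ℝ => expAvg g q.1 q.2 := by
  unfold expAvg
  refine continuous_of_dominated (bound := fun s => Real.exp (-s) * C) ?_ ?_ ?_ ?_
  · intro q
    exact (by fun_prop : Continuous fun s : ℝ =>
      Real.exp (-s) * g (q.2 - q.1 * s)).aestronglyMeasurable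
  · intro q
    refine Eventually.of_forall fun s => ?_
    rw [norm_mul, Real.norm_of_nonneg (Real.exp_pos _).le]
    exact mul_le_mul_of_nonneg_left (hC _) (Real.exp_pos _).le
  · exact Integrable.mul_const (integrableOn_exp_neg_Ioi 0) C
  · exact Eventually.of_forall fun s => by fun_prop

theorem abs_expAvg_le {g : ℝ → ℝ} {C : ℝ} (hC : ∀ x, |g x| ≤ C) (μ z : ℝ) :
    |expAvg g μ z| ≤ C := by
  have h := norm_integral_le_of_norm_le (μ := volume.restrict (Ioi (0 : ℝ)))
    (f := fun s => Real.exp (-s) * g (z - μ * s)) (g := fun s => Real.exp (-s) * C)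
    (Integrable.mul_const (integrableOn_exp_neg_Ioi 0) C) (Eventually.of_forall fun s => by
      rw [norm_mul, Real.norm_of_nonneg (Real.exp_pos _).le]
      exact mul_le_mul_of_nonneg_left (hC _) (Real.exp_pos _).le)
  rw [integral_mul_const, integral_exp_neg_Ioi_zero, one_mul] at h
  exact h

/-- The substitution `x = z - μ s` gives the integrating-factor form. There `z` is a limit of
integration, so differentiation in `z` needs only continuity of `g`. -/
theorem expAvg_eq {g : ℝ → ℝ} {μ : ℝ} (hμ : 0 < μ) (z : ℝ) :
    expAvg g μ z = Real.exp (-z / μ) / μ * ∫ x in Iic z, Real.exp (x / μ) * g x := by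
  have h1 : ∫ x in Iic z, Real.exp (x / μ) * g x
      = μ * ∫ s in Ioi (0 : ℝ), Real.exp ((z - μ * s) / μ) * g (z - μ * s) := by
    rw [← integral_indicator measurableSet_Iic, ← integral_indicator measurableSet_Ioi]
    have h2 := integral_sub_left_eq_self
      (fun x => (Iic z).indicator (fun x => Real.exp (x / μ) * g x) x) volume z
    rw [← h2]
    have h3 := Measure.integral_comp_mul_left
      (fun y => (Iic z).indicator (fun x => Real.exp (x / μ) * g x) (z - y)) μ
    rw [abs_of_pos (inv_pos.2 hμ), smul_eq_mul] at h3
    rw [eq_inv_mul_iff_mul_eq₀ hμ.ne'] at h3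
    rw [← h3]
    congr 1
    refine integral_congr_ae ?_
    have h0 : ∀ᵐ s : ℝ, s ≠ 0 := by simp [ae_iff]
    filter_upwards [h0] with s hs
    simp only [indicator, mem_Iic, mem_Ioi]
    have : z - μ * s ≤ z ↔ 0 < s := by
      rw [sub_le_self_iff, mul_nonneg_iff_of_pos_left hμ]
      exact ⟨fun h => lt_of_le_of_ne h hs.symm, le_of_lt⟩
    simp [this]
  rw [h1, expAvg, ← integral_const_mul, ← integral_const_mul]
  refine integral_congr_ae (Eventually.of_forall fun s => ?_)
  have : Real.exp (-s) = Real.exp (-z / μ) * Real.exp ((z - μ * s) / μ) := by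
    rw [← Real.exp_add]; congr 1; field_simp; ring
  simp only [this]
  field_simp

theorem hasDerivAt_expAvg {g : ℝ → ℝ} (hg : Continuous g) {C : ℝ} (hC : ∀ x, |g x| ≤ C)
    {μ : ℝ} (hμ : 0 < μ) (z : ℝ) :
    HasDerivAt (expAvg g μ) ((g z - expAvg g μ z) / μ) z := by
  have hint : ∀ a, IntegrableOn (fun x => Real.exp (x / μ) * g x) (Iic a) := by
    intro a
    refine Integrable.mul_bdd (c := C) ?_ hg.aestronglyMeasurable
      (Eventually.of_forall fun s => hC _)
    have := integrableOn_exp_mul_Iic (a := 1 / μ) (by positivity) a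
    refine this.congr_fun (fun x _ => ?_) measurableSet_Iic
    dsimp only; congr 1; ring
  have hc : Continuous fun x => Real.exp (x / μ) * g x := by fun_prop
  have h1 : HasDerivAt (fun z => ∫ x in Iic z, Real.exp (x / μ) * g x)
      (Real.exp (z / μ) * g z) z := by
    have h2 : (fun z => ∫ x in Iic z, Real.exp (x / μ) * g x) =
        fun z => (∫ x in Iic (0 : ℝ), Real.exp (x / μ) * g x)
          + ∫ x in (0 : ℝ)..z, Real.exp (x / μ) * g x := by
      funext y
      rw [← intervalIntegral.integral_Iic_sub_Iic (hint 0) (hint y)]; ring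
    rw [h2]
    exact (intervalIntegral.integral_hasDerivAt_right (hc.intervalIntegrable _ _)
      (hc.stronglyMeasurableAtFilter _ _) hc.continuousAt).const_add _
  have h3 : HasDerivAt (fun z : ℝ => Real.exp (-z / μ) / μ)
      (Real.exp (-z / μ) * (-1 / μ) / μ) z :=
    (((hasDerivAt_neg z).div_const μ).exp).div_const μ
  have h4 := h3.mul h1
  have h5 : expAvg g μ = (fun z : ℝ => Real.exp (-z / μ) / μ) *
      fun z => ∫ x in Iic z, Real.exp (x / μ) * g x := by
    funext y; exact expAvg_eq hμ y
  rw [expAvg_eq hμ z, h5]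
  refine h4.congr_deriv ?_
  have h6 : Real.exp (-z / μ) * Real.exp (z / μ) = 1 := by
    rw [← Real.exp_add]; simp [neg_div]
  have h7 : Real.exp (-z / μ) / μ * (Real.exp (z / μ) * g z) = g z / μ := by
    rw [div_mul_eq_mul_div, ← mul_assoc, h6, one_mul]
  rw [h7]; ring

theorem tendsto_expAvg {g : ℝ → ℝ} (hg : Continuous g) {C : ℝ} (hC : ∀ x, |g x| ≤ C)
    {μ ℓ : ℝ} {l : Filter ℝ} [l.IsCountablyGenerated]
    (h : ∀ s, Tendsto (fun z => g (z - μ * s)) l (𝓝 ℓ)) :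
    Tendsto (expAvg g μ) l (𝓝 ℓ) := by
  have h1 : ∫ s in Ioi (0 : ℝ), Real.exp (-s) * ℓ = ℓ := by
    rw [integral_mul_const, integral_exp_neg_Ioi_zero, one_mul]
  rw [← h1]
  unfold expAvg
  refine tendsto_integral_filter_of_dominated_convergence (fun s => Real.exp (-s) * C) ?_ ?_ ?_ ?_
  · exact Eventually.of_forall fun z => (by fun_prop : Continuous fun s : ℝ =>
      Real.exp (-s) * g (z - μ * s)).aestronglyMeasurable
  · refine Eventually.of_forall fun z => Eventually.of_forall fun s => ?_
    rw [norm_mul, Real.norm_of_nonneg (Real.exp_pos _).le]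
    exact mul_le_mul_of_nonneg_left (hC _) (Real.exp_pos _).le
  · exact Integrable.mul_const (integrableOn_exp_neg_Ioi 0) C
  · exact Eventually.of_forall fun s => (h s).const_mul _

theorem integrableOn_mul_exp_neg_Ioi : IntegrableOn (fun s : ℝ => s * Real.exp (-s)) (Ioi 0) := by
  have := Real.GammaIntegral_convergent (s := 2) (by norm_num)
  refine this.congr_fun (fun s _ => ?_) measurableSet_Ioi
  norm_num [mul_comm]

theorem integral_mul_exp_neg_Ioi : ∫ s in Ioi (0 : ℝ), s * Real.exp (-s) = 1 := by
  have h := Real.Gamma_eq_integral (s := 2) (by norm_num)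
  rw [Real.Gamma_two] at h
  rw [h]
  refine setIntegral_congr_fun measurableSet_Ioi (fun s _ => ?_)
  norm_num [mul_comm]

/-- Changing the speed moves the sample point by `|μ - ν| s`, and the weight `s e^{-s}` has mass
`1`. -/
theorem abs_expAvg_sub_le {g : ℝ → ℝ} (hg : Continuous g) {C : ℝ} (hC : ∀ x, |g x| ≤ C)
    {B : ℝ} (hB : ∀ x y, |g x - g y| ≤ B * |x - y|) (μ ν z : ℝ) :
    |expAvg g μ z - expAvg g ν z| ≤ B * |μ - ν| := by
  unfold expAvg
  rw [← integral_sub (integrableOn_expAvg hg hC μ z) (integrableOn_expAvg hg hC ν z)]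
  have h := norm_integral_le_of_norm_le (μ := volume.restrict (Ioi (0 : ℝ)))
    (f := fun s => Real.exp (-s) * g (z - μ * s) - Real.exp (-s) * g (z - ν * s))
    (g := fun s => s * Real.exp (-s) * (B * |μ - ν|))
    (integrableOn_mul_exp_neg_Ioi.mul_const _) (by
      refine (ae_restrict_iff' measurableSet_Ioi).2 (Eventually.of_forall fun s hs => ?_)
      rw [← mul_sub, norm_mul, Real.norm_of_nonneg (Real.exp_pos _).le]
      have h1 := hB (z - μ * s) (z - ν * s)
      have h2 : |z - μ * s - (z - ν * s)| = |μ - ν| * s := by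
        rw [show z - μ * s - (z - ν * s) = -((μ - ν) * s) by ring, abs_neg, abs_mul,
          abs_of_pos (mem_Ioi.1 hs)]
      rw [h2] at h1
      calc Real.exp (-s) * ‖g (z - μ * s) - g (z - ν * s)‖
          ≤ Real.exp (-s) * (B * (|μ - ν| * s)) :=
            mul_le_mul_of_nonneg_left h1 (Real.exp_pos _).le
        _ = _ := by ring)
  rw [integral_mul_const, integral_mul_exp_neg_Ioi, one_mul] at h
  exact h

/-- The solution of `μ F' + F = g` which vanishes at `-∞` is unique. -/
theorem eq_expAvg_of_hasDerivAt {g : ℝ → ℝ} (hg : Continuous g) {C : ℝ} (hC : ∀ x, |g x| ≤ C)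
    {μ : ℝ} (hμ : 0 < μ) (hg0 : Tendsto g atBot (𝓝 0)) {F : ℝ → ℝ}
    (hF : ∀ z, HasDerivAt F ((g z - F z) / μ) z) (hF0 : Tendsto F atBot (𝓝 0)) :
    F = expAvg g μ := by
  -- Integrating factor times the difference of two solutions: constant, and `0` in the limit at
  -- `-∞`.
  set w : ℝ → ℝ := fun z => Real.exp (z / μ) * (F z - expAvg g μ z) with hw
  have hd : ∀ z, HasDerivAt w 0 z := by
    intro z
    have h1 : HasDerivAt (fun z : ℝ => Real.exp (z / μ)) (Real.exp (z / μ) * (1 / μ)) z :=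
      ((hasDerivAt_id z).div_const μ).exp
    have h2 := h1.mul ((hF z).sub (hasDerivAt_expAvg hg hC hμ z))
    refine h2.congr_deriv ?_
    rw [Pi.sub_apply]
    field_simp
    ring
  have hconst : ∀ x y, w x = w y := is_const_of_deriv_eq_zero
    (fun z => (hd z).differentiableAt) fun z => (hd z).deriv
  have hlim : Tendsto w atBot (𝓝 (0 * (0 - 0))) := by
    refine Tendsto.mul ?_ (hF0.sub (tendsto_expAvg hg hC fun s => ?_))
    · exact Real.tendsto_exp_atBot.comp (tendsto_id.atBot_div_const hμ)
    · exact hg0.comp (tendsto_atBot_add_const_right _ _ tendsto_id)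
  funext z
  have hz : w z = 0 := by
    have h3 : Tendsto w atBot (𝓝 (w z)) := by
      rw [show w = fun _ => w z from funext fun x => hconst x z]
      exact tendsto_const_nhds
    simpa using tendsto_nhds_unique h3 hlim
  rcases mul_eq_zero.1 hz with h | h
  · exact absurd h (Real.exp_pos _).ne'
  · linarith

/-! ### The primitive of the kernel. -/

/-- The primitive of `K` which vanishes at `-∞`. -/
noncomputable def primitive (K : ℝ → ℝ) (x : ℝ) : ℝ := ∫ y in Iic x, K y

namespace IsLateralInhibitionKernel

variable {K : ℝ → ℝ} {M : ℝ}

theorem primitive_zero (hK : IsLateralInhibitionKernel K M) : primitive K 0 = 1 / 2 :=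
  hK.integral_left

theorem integral_Ioi (hK : IsLateralInhibitionKernel K M) (x : ℝ) :
    ∫ y in Ioi x, K y = primitive K (-x) := by
  rw [primitive, ← integral_comp_neg_Ioi]
  simp [hK.symmetric]

theorem integral_eq_one (hK : IsLateralInhibitionKernel K M) : ∫ x, K x = 1 := by
  rw [← intervalIntegral.integral_Iic_add_Ioi (b := 0) hK.integrable.integrableOn
    hK.integrable.integrableOn, hK.integral_left, hK.integral_right]
  norm_num

theorem primitive_neg (hK : IsLateralInhibitionKernel K M) (x : ℝ) :
    primitive K (-x) = 1 - primitive K x := by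
  rw [← hK.integral_Ioi, ← hK.integral_eq_one, primitive,
    ← intervalIntegral.integral_Iic_add_Ioi (b := x) hK.integrable.integrableOn
    hK.integrable.integrableOn]
  ring

theorem intervalIntegral_eq (hK : IsLateralInhibitionKernel K M) (a b : ℝ) :
    ∫ x in a..b, K x = primitive K b - primitive K a :=
  (intervalIntegral.integral_Iic_sub_Iic hK.integrable.integrableOn
    hK.integrable.integrableOn).symm

theorem hasDerivAt_primitive (hK : IsLateralInhibitionKernel K M) (x : ℝ) :
    HasDerivAt (primitive K) (K x) x := by
  have h : primitive K = fun x => primitive K 0 + ∫ y in (0 : ℝ)..x, K y := by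
    funext y; rw [hK.intervalIntegral_eq]; ring
  rw [h]
  exact (intervalIntegral.integral_hasDerivAt_right (hK.continuous.intervalIntegrable _ _)
    (hK.continuous.stronglyMeasurableAtFilter _ _) hK.continuous.continuousAt).const_add _

theorem continuous_primitive (hK : IsLateralInhibitionKernel K M) : Continuous (primitive K) :=
  continuous_iff_continuousAt.2 fun x => (hK.hasDerivAt_primitive x).continuousAt

theorem exists_bound (hK : IsLateralInhibitionKernel K M) : ∃ B, 0 < B ∧ ∀ x, |K x| ≤ B := by
  obtain ⟨C, ρ, hρ, h⟩ := hK.exp_bound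
  have hC : 0 ≤ C := by simpa using (abs_nonneg _).trans (h 0)
  refine ⟨C + 1, by linarith, fun x => (h x).trans ?_⟩
  have : Real.exp (-ρ * |x|) ≤ 1 := Real.exp_le_one_iff.2 (by nlinarith [abs_nonneg x])
  nlinarith

theorem abs_primitive_le (hK : IsLateralInhibitionKernel K M) (x : ℝ) :
    |primitive K x| ≤ ∫ y, |K y| :=
  (abs_integral_le_integral_abs).trans
    (setIntegral_le_integral hK.integrable.abs (Eventually.of_forall fun _ => abs_nonneg _))

theorem abs_primitive_sub_le (hK : IsLateralInhibitionKernel K M) {B : ℝ} (hB : ∀ x, |K x| ≤ B)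
    (x y : ℝ) : |primitive K x - primitive K y| ≤ B * |x - y| := by
  rw [← hK.intervalIntegral_eq]
  have h := intervalIntegral.norm_integral_le_of_norm_le_const (a := y) (b := x) (f := K)
    fun z _ => hB z
  exact h

theorem tendsto_atTop (hK : IsLateralInhibitionKernel K M) : Tendsto K atTop (𝓝 0) := by
  obtain ⟨C, ρ, hρ, h⟩ := hK.exp_bound
  refine squeeze_zero_norm h ?_
  have h1 : Tendsto (fun x : ℝ => -ρ * |x|) atTop atBot :=
    tendsto_abs_atTop_atTop.const_mul_atTop_of_neg (by linarith)
  simpa using (Real.tendsto_exp_atBot.comp h1).const_mul C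

theorem tendsto_atBot (hK : IsLateralInhibitionKernel K M) : Tendsto K atBot (𝓝 0) := by
  have := hK.tendsto_atTop.comp tendsto_neg_atBot_atTop
  exact this.congr fun x => hK.symmetric x

theorem tendsto_primitive_atTop (hK : IsLateralInhibitionKernel K M) :
    Tendsto (primitive K) atTop (𝓝 1) := by
  rw [← hK.integral_eq_one]
  have h := intervalIntegral_tendsto_integral_Ioi 0 hK.integrable.integrableOn tendsto_id
  rw [hK.integral_right] at h
  have h2 := h.const_add (primitive K 0)
  rw [hK.integral_eq_one]
  rw [hK.primitive_zero] at h2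
  norm_num at h2
  refine h2.congr fun x => ?_
  rw [hK.intervalIntegral_eq, hK.primitive_zero]; ring

theorem tendsto_primitive_atBot (hK : IsLateralInhibitionKernel K M) :
    Tendsto (primitive K) atBot (𝓝 0) := by
  have h := (hK.tendsto_primitive_atTop.comp tendsto_neg_atBot_atTop).const_sub 1
  rw [sub_self] at h
  refine h.congr fun x => ?_
  simp only [Function.comp, hK.primitive_neg]; ring

theorem strictMonoOn_primitive (hK : IsLateralInhibitionKernel K M) :
    StrictMonoOn (primitive K) (Icc (-M) M) := by
  refine strictMonoOn_of_deriv_pos (convex_Icc _ _) hK.continuous_primitive.continuousOn ?_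
  intro x hx
  rw [interior_Icc] at hx
  rw [(hK.hasDerivAt_primitive x).deriv]
  exact hK.pos_inside x (abs_lt.2 hx)

theorem strictAntiOn_primitive_Ici (hK : IsLateralInhibitionKernel K M) :
    StrictAntiOn (primitive K) (Ici M) := by
  refine strictAntiOn_of_deriv_neg (convex_Ici _) hK.continuous_primitive.continuousOn ?_
  intro x hx
  rw [interior_Ici] at hx
  rw [(hK.hasDerivAt_primitive x).deriv]
  exact hK.neg_outside x (hx.trans_le (le_abs_self x))

/-- Beyond `M` the primitive decreases strictly to its limit `1`; the comparison with `x + 1` keeps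
the inequality strict. -/
theorem one_lt_primitive (hK : IsLateralInhibitionKernel K M) {x : ℝ} (hx : M ≤ x) :
    1 < primitive K x := by
  have h1 : 1 ≤ primitive K (x + 1) := by
    refine le_of_tendsto hK.tendsto_primitive_atTop ?_
    filter_upwards [eventually_ge_atTop (x + 1)] with y hy
    exact hK.strictAntiOn_primitive_Ici.antitoneOn (by simp; linarith) (by simp; linarith) hy
  exact h1.trans_lt (hK.strictAntiOn_primitive_Ici hx (by simp; linarith) (by linarith))

end IsLateralInhibitionKernel

/-! ### The constants `σ₁`, `σ₂`, `σ₃`. -/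

theorem StrictAntiOn.isUniquePositive {f : ℝ → ℝ} {A v : ℝ} (hA : 0 < A)
    (hf : ContinuousOn f (Icc 0 A)) (hanti : StrictAntiOn f (Icc 0 A)) (h0 : v < f 0)
    (h1 : ∀ s, A ≤ s → f s < v) : ∃ σ, IsUniquePositive (fun s => f s = v) σ := by
  obtain ⟨σ, hσ, hσv⟩ := intermediate_value_Icc' hA.le hf ⟨(h1 A le_rfl).le, h0.le⟩
  refine ⟨σ, hσ.1.lt_of_ne ?_, hσv, fun s hs hsv => ?_⟩
  · rintro rfl; exact h0.ne' hσv
  · have hsA : s ≤ A := by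
      by_contra h
      exact (h1 s (not_le.1 h).le).ne hsv
    exact hanti.injOn ⟨hs.le, hsA⟩ hσ (hsv.trans hσv.symm)

namespace IsLateralInhibitionKernel

variable {K : ℝ → ℝ} {M : ℝ}

theorem exists_isSigma1 (hK : IsLateralInhibitionKernel K M) : ∃ σ, IsSigma1 K σ := by
  obtain ⟨σ, hσ⟩ := StrictAntiOn.isUniquePositive (f := fun s => primitive K (-s)) (v := 0)
    hK.M_pos (hK.continuous_primitive.comp continuous_neg).continuousOn
    (fun s hs t ht hst => hK.strictMonoOn_primitive ⟨by linarith [ht.2], by linarith [ht.1, hK.M_pos]⟩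
      ⟨by linarith [hs.2], by linarith [hs.1, hK.M_pos]⟩ (neg_lt_neg hst))
    (by simp [hK.primitive_zero])
    (fun s hs => by rw [hK.primitive_neg]; linarith [hK.one_lt_primitive hs])
  refine ⟨σ, ?_⟩
  unfold IsSigma1
  simp only [hK.integral_Ioi]
  simpa [primitive] using hσ

/-- The left side exceeds `1` at `s = 0` and decreases strictly up to `s = 2M`, where `M - s` leaves
`[-M, M]`. From there on it is negative: the reflection `primitive_neg` makes the first term
negative, and the other two add up to at most `0`. -/
theorem exists_isUniquePositive_primitive_add (hK : IsLateralInhibitionKernel K M) {v : ℝ}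
    (hv0 : 0 ≤ v) (hv1 : v ≤ 1) :
    ∃ σ, IsUniquePositive
      (fun s => primitive K (M - s) + primitive K (M + s) - primitive K M = v) σ := by
  have hM := hK.M_pos
  have hle : ∀ s, 0 ≤ s → primitive K (M + s) ≤ primitive K M := fun s hs =>
    hK.strictAntiOn_primitive_Ici.antitoneOn self_mem_Ici (by simpa using hs) (by linarith)
  refine StrictAntiOn.isUniquePositive (A := 2 * M) (by linarith) ?_ ?_ ?_ ?_
  · have := hK.continuous_primitive
    exact Continuous.continuousOn (by fun_prop)
  · intro s hs t ht hst
    have h1 := hK.strictMonoOn_primitive (a := M - t) (b := M - s)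
      ⟨by linarith [ht.2], by linarith [ht.1]⟩ ⟨by linarith [hs.2], by linarith [hs.1]⟩
      (by linarith)
    have h2 := hK.strictAntiOn_primitive_Ici (a := M + s) (b := M + t)
      (by simpa using hs.1) (by simpa using ht.1) (by linarith)
    dsimp only
    linarith
  · simp only [sub_zero, add_zero]
    linarith [hK.one_lt_primitive le_rfl]
  · intro s hs
    have h1 := hle s (by linarith)
    have h2 := hK.primitive_neg (s - M)
    have h3 := hK.one_lt_primitive (x := s - M) (by linarith)
    rw [neg_sub] at h2
    linarith

theorem isSigma3_iff (hK : IsLateralInhibitionKernel K M) {v σ : ℝ} :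
    IsSigma3 K M v σ ↔ IsUniquePositive
      (fun s => primitive K (M - s) + primitive K (M + s) - primitive K M = v) σ := by
  unfold IsSigma3
  simp only [hK.intervalIntegral_eq, ← add_sub_assoc]
  rfl

/-- Reflection `x ↦ -x` exchanges the two equations, so every fact about `σ₃` also serves `σ₂`. -/
theorem isSigma2_iff (hK : IsLateralInhibitionKernel K M) {v σ : ℝ} :
    IsSigma2 K M v σ ↔ IsSigma3 K M (1 - v) σ := by
  have h : (fun s => (∫ x in Iic (-M - s), K x) + (∫ x in (-M)..(-M + s), K x) = v) =
      fun s => primitive K (M - s) + primitive K (M + s) - primitive K M = 1 - v := by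
    funext s
    have h1 := hK.primitive_neg (M + s)
    have h2 := hK.primitive_neg (M - s)
    rw [show -(M + s) = -M - s by ring] at h1
    rw [show -(M - s) = -M + s by ring] at h2
    rw [hK.intervalIntegral_eq, show (∫ x in Iic (-M - s), K x) = primitive K (-M - s) from rfl,
      h1, h2, hK.primitive_neg M, eq_iff_iff]
    constructor <;> intro h <;> linarith
  rw [hK.isSigma3_iff, IsSigma2, h]

theorem exists_isSigma3 (hK : IsLateralInhibitionKernel K M) {v : ℝ} (hv0 : 0 ≤ v) (hv1 : v ≤ 1) :
    ∃ σ, IsSigma3 K M v σ := by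
  simpa only [hK.isSigma3_iff] using hK.exists_isUniquePositive_primitive_add hv0 hv1

theorem exists_isSigma2 (hK : IsLateralInhibitionKernel K M) {v : ℝ} (hv0 : 0 ≤ v) (hv1 : v ≤ 1) :
    ∃ σ, IsSigma2 K M v σ := by
  simpa only [hK.isSigma2_iff] using hK.exists_isSigma3 (v := 1 - v) (by linarith) (by linarith)

/-- Near `s = 0` the defining expression is still above `1`, hence above every admissible level. The
bound is uniform in `v`, as needed when the level `θ + τ` varies. -/
theorem exists_le_sigma3 (hK : IsLateralInhibitionKernel K M) :
    ∃ s₀, 0 < s₀ ∧ ∀ v, v ≤ 1 → ∀ σ, IsSigma3 K M v σ → s₀ ≤ σ := by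
  have hc := hK.continuous_primitive
  have hc2 : Continuous fun s => primitive K (M - s) + primitive K (M + s) - primitive K M := by
    fun_prop
  have h0 : ∀ᶠ s in 𝓝 (0 : ℝ), 1 < primitive K (M - s) + primitive K (M + s) - primitive K M := by
    refine hc2.continuousAt.eventually_const_lt ?_
    simpa using hK.one_lt_primitive le_rfl
  obtain ⟨s₀, hs₀, h⟩ := Metric.eventually_nhds_iff.1 h0
  refine ⟨s₀, hs₀, fun v hv1 σ hσ => ?_⟩
  obtain ⟨hσ0, h4, -⟩ := hK.isSigma3_iff.1 hσ
  by_contra hlt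
  have h5 := h (y := σ) (by rw [Real.dist_eq, sub_zero, abs_of_pos hσ0]; linarith)
  linarith

/-! ### Monotone dependence of the threshold on the speed. -/

theorem hasDerivAt_expAvg_primitive_speed (hK : IsLateralInhibitionKernel K M) (μ : ℝ) :
    HasDerivAt (fun μ => expAvg (primitive K) μ 0)
      (-∫ s in Ioi (0 : ℝ), s * Real.exp (-s) * K (μ * s)) μ := by
  obtain ⟨B, hB0, hB⟩ := hK.exists_bound
  have hW := hK.continuous_primitive
  have hKc := hK.continuous
  have h := hasDerivAt_integral_of_dominated_loc_of_deriv_le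
    (μ := volume.restrict (Ioi (0 : ℝ)))
    (F := fun μ s => Real.exp (-s) * primitive K (0 - μ * s))
    (F' := fun μ s => Real.exp (-s) * (K (0 - μ * s) * (-s))) (x₀ := μ) (s := univ)
    (bound := fun s => s * Real.exp (-s) * B) univ_mem
    (Eventually.of_forall fun ν => (by fun_prop : Continuous fun s : ℝ =>
      Real.exp (-s) * primitive K (0 - ν * s)).aestronglyMeasurable)
    (integrableOn_expAvg hW hK.abs_primitive_le μ 0)
    (by fun_prop : Continuous fun s : ℝ =>
      Real.exp (-s) * (K (0 - μ * s) * (-s))).aestronglyMeasurable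
    ((ae_restrict_iff' measurableSet_Ioi).2 (Eventually.of_forall fun s hs ν _ => by
      rw [norm_mul, norm_mul, norm_neg, Real.norm_of_nonneg (Real.exp_pos _).le,
        Real.norm_of_nonneg (le_of_lt hs), Real.norm_eq_abs]
      calc Real.exp (-s) * (|K (0 - ν * s)| * s) = s * Real.exp (-s) * |K (0 - ν * s)| := by ring
        _ ≤ _ := mul_le_mul_of_nonneg_left (hB _) (mul_nonneg (le_of_lt hs) (Real.exp_pos _).le)))
    (integrableOn_mul_exp_neg_Ioi.mul_const B)
    (Eventually.of_forall fun s ν _ => by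
      have h1 : HasDerivAt (fun ν : ℝ => 0 - ν * s) (-s) ν := by
        simpa using ((hasDerivAt_id ν).mul_const s).const_sub 0
      exact ((hK.hasDerivAt_primitive _).comp ν h1).const_mul _)
  refine h.2.congr_deriv ?_
  rw [← integral_neg]
  refine integral_congr_ae (Eventually.of_forall fun s => ?_)
  dsimp only
  rw [zero_sub, hK.symmetric]; ring

/-- Integration by parts. The antiderivative `1 - e^{-s}` of `e^{-s}` vanishes at `0`, and
`primitive K` vanishes at `-∞`, so there are no boundary terms. -/
theorem expAvg_primitive_zero_eq (hK : IsLateralInhibitionKernel K M) {μ : ℝ} (hμ : 0 < μ) :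
    IntegrableOn (fun s => (1 - Real.exp (-s)) * K (μ * s)) (Ioi 0) ∧
    expAvg (primitive K) μ 0 = μ * ∫ s in Ioi (0 : ℝ), (1 - Real.exp (-s)) * K (μ * s) := by
  have hW := hK.continuous_primitive
  have hKc := hK.continuous
  have hi : IntegrableOn (fun s => (1 - Real.exp (-s)) * K (μ * s)) (Ioi 0) := by
    refine Integrable.bdd_mul (c := 1) (hK.integrable.comp_mul_left' hμ.ne').integrableOn
      (by fun_prop : Continuous fun s : ℝ => 1 - Real.exp (-s)).aestronglyMeasurable ?_
    refine (ae_restrict_iff' measurableSet_Ioi).2 (Eventually.of_forall fun s hs => ?_)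
    have h1 : Real.exp (-s) ≤ 1 := Real.exp_le_one_iff.2 (by linarith [mem_Ioi.1 hs])
    rw [Real.norm_of_nonneg (by linarith)]
    linarith [Real.exp_pos (-s)]
  refine ⟨hi, ?_⟩
  have hi2 := integrableOn_expAvg hW hK.abs_primitive_le μ 0
  have h := integral_Ioi_of_hasDerivAt_of_tendsto (a := 0) (m := 0)
    (f := fun s => (1 - Real.exp (-s)) * primitive K (0 - μ * s))
    (f' := fun s => Real.exp (-s) * primitive K (0 - μ * s)
      - μ * ((1 - Real.exp (-s)) * K (μ * s)))
    (Continuous.continuousWithinAt (by fun_prop))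
    (fun s _ => by
      have h1 : HasDerivAt (fun s : ℝ => 1 - Real.exp (-s)) (Real.exp (-s)) s := by
        simpa using (hasDerivAt_neg s).exp.const_sub 1
      have h2 : HasDerivAt (fun s : ℝ => 0 - μ * s) (-μ) s := by
        simpa using ((hasDerivAt_id s).const_mul μ).const_sub 0
      refine (h1.mul ((hK.hasDerivAt_primitive _).comp s h2)).congr_deriv ?_
      rw [Function.comp_apply, zero_sub, hK.symmetric]; ring)
    (hi2.sub (hi.const_mul μ)) (by
      have h1 : Tendsto (fun s : ℝ => 1 - Real.exp (-s)) atTop (𝓝 (1 - 0)) :=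
        (Real.tendsto_exp_atBot.comp tendsto_neg_atTop_atBot).const_sub 1
      have h2 : Tendsto (fun s : ℝ => 0 - μ * s) atTop atBot := by
        simpa using tendsto_id.const_mul_atTop_of_neg (neg_lt_zero.2 hμ)
      simpa using h1.mul (hK.tendsto_primitive_atBot.comp h2))
  rw [integral_sub hi2 (hi.const_mul μ), integral_const_mul] at h
  simp only [neg_zero, Real.exp_zero, sub_self, zero_mul] at h
  unfold expAvg
  linarith

/-- The threshold reached by the Heaviside front depends strictly monotonically on the speed. -/
theorem integral_mul_exp_mul_pos (hK : IsLateralInhibitionKernel K M) {μ : ℝ} (hμ : 0 < μ)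
    (h : 0 < expAvg (primitive K) μ 0) :
    0 < ∫ s in Ioi (0 : ℝ), s * Real.exp (-s) * K (μ * s) := by
  obtain ⟨B, hB0, hB⟩ := hK.exists_bound
  obtain ⟨hi, he⟩ := hK.expAvg_primitive_zero_eq hμ
  rw [he, mul_pos_iff_of_pos_left hμ] at h
  have hKc := hK.continuous
  have hi2 : IntegrableOn (fun s => s * Real.exp (-s) * K (μ * s)) (Ioi 0) :=
    integrableOn_mul_exp_neg_Ioi.mul_bdd (c := B)
      (by fun_prop : Continuous fun s => K (μ * s)).aestronglyMeasurable
      (Eventually.of_forall fun s => hB _)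
  -- The point where `s ↦ K (μ s)` changes sign from plus to minus.
  set a := M / μ with ha
  have ha0 : 0 < a := div_pos hK.M_pos hμ
  have hea : 0 < Real.exp a - 1 := by linarith [Real.add_one_lt_exp ha0.ne']
  -- Convexity of `exp`: the quotient `(e^s - 1) / s`, which is the ratio of the weights `1 -
  -- e^{-s}` and `s e^{-s}`, increases.
  have hmono : ∀ s t : ℝ, 0 < s → s ≤ t → t * (Real.exp s - 1) ≤ s * (Real.exp t - 1) := by
    intro s t hs hst
    have ht : 0 < t := hs.trans_le hst
    have h1 : 0 ≤ 1 - s / t := by rw [sub_nonneg, div_le_one ht]; exact hst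
    have h2 : 0 ≤ s / t := by positivity
    have := convexOn_exp.2 (mem_univ 0) (mem_univ t) h1 h2 (by ring)
    simp only [smul_eq_mul, mul_zero, zero_add, Real.exp_zero, mul_one,
      div_mul_cancel₀ _ ht.ne'] at this
    have h4 : t * Real.exp s ≤ t * (1 - s / t + s / t * Real.exp t) :=
      mul_le_mul_of_nonneg_left this ht.le
    have h3 : t * (1 - s / t + s / t * Real.exp t) = t - s + s * Real.exp t := by
      field_simp
    linarith
  -- The weight ratio crosses its value at `a` exactly where `K (μ s)` changes sign, so the
  -- difference of the two sides keeps one sign. Integration then bounds the wanted integral below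
  -- by a positive multiple of a positive one.
  have hpt : ∀ s ∈ Ioi (0 : ℝ), a * ((1 - Real.exp (-s)) * K (μ * s)) ≤
      (Real.exp a - 1) * (s * Real.exp (-s) * K (μ * s)) := by
    intro s hs
    have hs0 : 0 < s := hs
    have h1 : 1 - Real.exp (-s) = Real.exp (-s) * (Real.exp s - 1) := by
      rw [mul_sub, ← Real.exp_add]; simp
    rw [h1]
    have h2 : 0 ≤ (s * (Real.exp a - 1) - a * (Real.exp s - 1)) * K (μ * s) := by
      rcases lt_trichotomy s a with hlt | heq | hgt
      · refine mul_nonneg (sub_nonneg.2 (hmono s a hs0 hlt.le)) (hK.pos_inside _ ?_).le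
        rw [abs_of_pos (by positivity)]
        rwa [ha, lt_div_iff₀ hμ, mul_comm] at hlt
      · rw [heq]; simp
      · refine mul_nonneg_of_nonpos_of_nonpos (sub_nonpos.2 (hmono a s ha0 hgt.le))
          (hK.neg_outside _ ?_).le
        rw [abs_of_pos (by positivity)]
        rwa [ha, div_lt_iff₀ hμ, mul_comm] at hgt
    have h3 := mul_nonneg (Real.exp_pos (-s)).le h2
    nlinarith [h3]
  have h4 := setIntegral_mono_on (hi.const_mul a) (hi2.const_mul (Real.exp a - 1))
    measurableSet_Ioi hpt
  rw [integral_const_mul, integral_const_mul] at h4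
  exact pos_of_mul_pos_right ((mul_pos ha0 h).trans_le h4) hea.le

end IsLateralInhibitionKernel

/-! ### Tools for choosing the speed. -/

theorem HasDerivAt.exists_lt_gt_of_neg {f : ℝ → ℝ} {f' x δ : ℝ} (hf : HasDerivAt f f' x)
    (hf' : f' < 0) (hδ : 0 < δ) :
    ∃ a b, x - δ < a ∧ a < x ∧ x < b ∧ b < x + δ ∧ f x < f a ∧ f b < f x := by
  have h := hasDerivAt_iff_tendsto_slope.1 hf
  have h1 : ∀ᶠ y in 𝓝[≠] x, slope f x y < 0 := h.eventually_lt_const hf'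
  have hL : ∀ᶠ y in 𝓝[<] x, slope f x y < 0 :=
    h1.filter_mono (nhdsWithin_mono _ fun y hy => ne_of_lt hy)
  have hR : ∀ᶠ y in 𝓝[>] x, slope f x y < 0 :=
    h1.filter_mono (nhdsWithin_mono _ fun y hy => ne_of_gt hy)
  obtain ⟨a, ha, ha2⟩ := (hL.and (Ioo_mem_nhdsLT (show x - δ < x by linarith))).exists
  obtain ⟨b, hb, hb2⟩ := (hR.and (Ioo_mem_nhdsGT (show x < x + δ by linarith))).exists
  refine ⟨a, b, ha2.1, ha2.2, hb2.1, hb2.2, ?_, ?_⟩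
  · rw [slope_def_field, div_neg_iff] at ha
    rcases ha with ha | ha <;> linarith [ha2.2, ha.1, ha.2]
  · rw [slope_def_field, div_neg_iff] at hb
    rcases hb with hb | hb <;> linarith [hb2.1, hb.1, hb.2]

/-- With a common contraction constant, the a priori estimate bounds the distance from the old fixed
point to the new one by `dist x (T p x) / (1 - c)`. Continuity of `T` in `p` at that single point is
enough. -/
theorem ContractingWith.continuous_fixedPoint_param {P X : Type*} [TopologicalSpace P]
    [MetricSpace X] [CompleteSpace X] [Nonempty X] {c : NNReal} {T : P → X → X}
    (hT : ∀ p, ContractingWith c (T p)) (hc : ∀ x, Continuous fun p => T p x) :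
    Continuous fun p => (hT p).fixedPoint := by
  refine continuous_iff_continuousAt.2 fun q => ?_
  rw [ContinuousAt, tendsto_iff_dist_tendsto_zero]
  set x := (hT q).fixedPoint with hx
  have h1 : Tendsto (fun p => dist x (T p x) / (1 - c)) (𝓝 q) (𝓝 0) := by
    have h2 : Tendsto (fun p => dist x (T p x)) (𝓝 q) (𝓝 (dist x (T q x))) :=
      tendsto_const_nhds.dist ((hc x).tendsto q)
    have h3 : T q x = x := (hT q).fixedPoint_isFixedPt
    rw [h3, dist_self] at h2
    simpa using h2.div_const (1 - (c : ℝ))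
  refine squeeze_zero (fun _ => dist_nonneg) (fun p => ?_) h1
  rw [dist_comm]
  exact (hT p).dist_fixedPoint_le x

/-! ### Ramps composed with steep firing rates. -/

/-- `v` increases at rate at least `m` on `[0, L]`, from the value `θ` at `0`, and is constant to
the left and to the right of this interval. -/
structure IsRamp (m L θ : ℝ) (v : ℝ → ℝ) : Prop where
  continuous : Continuous v
  left : ∀ x ≤ 0, v x = θ
  right : ∀ x, L ≤ x → v x = v L
  slope : ∀ x y, 0 ≤ x → x ≤ y → y ≤ L → m * (y - x) ≤ v y - v x

namespace IsRamp

variable {m L θ : ℝ} {v w : ℝ → ℝ} {S : ℝ → ℝ}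

theorem le_right (hL : 0 ≤ L) (hv : IsRamp m L θ v) {x : ℝ} (hx : L ≤ x) : θ + m * L ≤ v x := by
  have := hv.slope 0 L le_rfl hL le_rfl
  rw [hv.left 0 le_rfl] at this
  rw [hv.right x hx]
  linarith

/-- A shift to the right by `h` raises a ramp by `m h`, unless it passes `L`; but there the firing
rate is already saturated at `1`. -/
theorem le_comp_shift (hL : 0 ≤ L) (hS : Monotone S) (hS1 : ∀ u, m * L ≤ u → S u = 1)
    (hSle : ∀ u, S u ≤ 1) (hw : IsRamp m L θ w) {h : ℝ} (hh : 0 ≤ h) {y a : ℝ}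
    (hy : y ∈ Icc 0 L) (hvw : a ≤ w y + m * h) : S (a - θ) ≤ S (w (y + h) - θ) := by
  rcases le_total (y + h) L with h1 | h1
  · refine hS ?_
    have := hw.slope y (y + h) hy.1 (by linarith) h1
    linarith
  · rw [hS1 (w (y + h) - θ) (by linarith [hw.le_right hL h1])]
    exact hSle _

theorem comp_shift_le (hS : Monotone S) (hS0 : ∀ u, u ≤ 0 → S u = 0)
    (hSnn : ∀ u, 0 ≤ S u) (hw : IsRamp m L θ w) {h : ℝ} (hh : 0 ≤ h) {y a : ℝ}
    (hy : y ∈ Icc 0 L) (hvw : w y - m * h ≤ a) : S (w (y - h) - θ) ≤ S (a - θ) := by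
  rcases le_total 0 (y - h) with h1 | h1
  · refine hS ?_
    have := hw.slope (y - h) y h1 (by linarith) hy.2
    linarith
  · rw [hS0 (w (y - h) - θ) (by rw [hw.left _ h1]; linarith)]
    exact hSnn _

/-- The composition with a (possibly steep) firing rate is Lipschitz from the uniform norm on
ramps to `L¹`. -/
theorem integral_abs_comp_sub_le (hL : 0 ≤ L) (hm : 0 < m) (hS : Monotone S) (hSc : Continuous S)
    (hS0 : ∀ u, u ≤ 0 → S u = 0) (hS1 : ∀ u, m * L ≤ u → S u = 1)
    (hSnn : ∀ u, 0 ≤ S u) (hSle : ∀ u, S u ≤ 1)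
    (hv : IsRamp m L θ v) (hw : IsRamp m L θ w) {ε : ℝ} (hε : 0 ≤ ε)
    (hvw : ∀ y ∈ Icc 0 L, |v y - w y| ≤ ε) :
    ∫ y in (0 : ℝ)..L, |S (v y - θ) - S (w y - θ)| ≤ 2 * (ε / m) := by
  set h := ε / m with hh
  have hh0 : 0 ≤ h := by positivity
  have hmh : m * h = ε := by rw [hh]; field_simp
  set f : ℝ → ℝ := fun y => S (w y - θ) with hf
  have hwc := hw.continuous
  have hvc := hv.continuous
  have hfc : Continuous f := by fun_prop
  -- Both compositions lie between the shifts of `f` by `-h` and `h`. The integral of the gap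
  -- telescopes to two windows of width `2h` at the ends of `[0, L]`, whence the bound `2h`,
  -- independent of the steepness of `S`.
  have h1 : ∫ y in (0 : ℝ)..L, |S (v y - θ) - f y| ≤ ∫ y in (0 : ℝ)..L, (f (y + h) - f (y - h)) := by
    refine intervalIntegral.integral_mono_on hL (Continuous.intervalIntegrable (by fun_prop) _ _)
      (Continuous.intervalIntegrable (by fun_prop) _ _) fun y hy => ?_
    have h2 := abs_le.1 (hvw y hy)
    have a1 : S (v y - θ) ≤ f (y + h) :=
      le_comp_shift hL hS hS1 hSle hw hh0 hy (by linarith)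
    have a2 : f y ≤ f (y + h) := le_comp_shift hL hS hS1 hSle hw hh0 hy (by linarith)
    have a3 : f (y - h) ≤ S (v y - θ) := comp_shift_le hS hS0 hSnn hw hh0 hy (by linarith)
    have a4 : f (y - h) ≤ f y := comp_shift_le hS hS0 hSnn hw hh0 hy (by linarith)
    rw [abs_le]
    constructor <;> linarith
  refine h1.trans ?_
  have hi : ∀ a b, IntervalIntegrable f volume a b := fun a b => hfc.intervalIntegrable a b
  rw [intervalIntegral.integral_sub (Continuous.intervalIntegrable (by fun_prop) _ _)
    (Continuous.intervalIntegrable (by fun_prop) _ _),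
    intervalIntegral.integral_comp_add_right, intervalIntegral.integral_comp_sub_right,
    intervalIntegral.integral_interval_sub_interval_comm' (hi _ _) (hi _ _) (hi _ _)]
  have b1 : ∫ y in (L - h)..(L + h), f y ≤ ∫ y in (L - h)..(L + h), (1 : ℝ) :=
    intervalIntegral.integral_mono_on (by linarith) (hi _ _) (by simp) fun y _ => hSle _
  have b2 : 0 ≤ ∫ y in (0 - h)..(0 + h), f y :=
    intervalIntegral.integral_nonneg (by linarith) fun y _ => hSnn _
  simp only [intervalIntegral.integral_const, smul_eq_mul, mul_one] at b1
  linarith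

end IsRamp

/-! ### The fixed point problem near the threshold. -/

/-- The right-hand side of the profile equation for speed parameter `μ`, shifted so as to have
the value `θ` at `0`. -/
noncomputable def profileMap (Φ k : ℝ → ℝ → ℝ) (S : ℝ → ℝ) (θ L μ : ℝ) (v : ℝ → ℝ) (z : ℝ) : ℝ :=
  θ + (Φ μ z - Φ μ 0) - ∫ y in (0 : ℝ)..L, (k μ (z - y) - k μ (-y)) * (1 - S (v y - θ))

section profileMap

variable {Φ k : ℝ → ℝ → ℝ} {S : ℝ → ℝ} {m L θ B B₁ μ μ₁ μ₂ : ℝ} {v w : ℝ → ℝ}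

theorem profileMap_zero : profileMap Φ k S θ L μ v 0 = θ := by simp [profileMap]

theorem continuous_profileMap (hΦ : Continuous fun q : ℝ × ℝ => Φ q.1 q.2)
    (hk : Continuous fun q : ℝ × ℝ => k q.1 q.2) (hS : Continuous S) (hv : Continuous v) :
    Continuous fun q : ℝ × ℝ => profileMap Φ k S θ L q.1 v q.2 := by
  unfold profileMap
  refine Continuous.sub ?_ ?_
  · exact continuous_const.add (hΦ.sub (hΦ.comp (by fun_prop :
      Continuous fun q : ℝ × ℝ => (q.1, (0 : ℝ)))))
  · refine intervalIntegral.continuous_parametric_intervalIntegral_of_continuous' ?_ _ _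
    refine Continuous.mul (Continuous.sub ?_ ?_) (by fun_prop)
    · exact hk.comp (by fun_prop : Continuous fun q : (ℝ × ℝ) × ℝ => (q.1.1, q.1.2 - q.2))
    · exact hk.comp (by fun_prop : Continuous fun q : (ℝ × ℝ) × ℝ => (q.1.1, -q.2))

/-- Thanks to the normalisation at `0`, only the increment from `k μ (-y)` to `k μ (z - y)` enters.
It is at most `B₁ L`, the small factor of the contraction. -/
theorem abs_profileMap_sub_le (hL : 0 ≤ L) (hkc : Continuous (k μ))
    (hkL : ∀ x y, |k μ x - k μ y| ≤ B₁ * |x - y|) (hS : Continuous S) (hv : Continuous v)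
    (hw : Continuous w) {z : ℝ} (hz : z ∈ Icc 0 L) (hB₁ : 0 ≤ B₁) :
    |profileMap Φ k S θ L μ v z - profileMap Φ k S θ L μ w z| ≤
      B₁ * L * ∫ y in (0 : ℝ)..L, |S (v y - θ) - S (w y - θ)| := by
  unfold profileMap
  rw [sub_sub_sub_cancel_left, ← intervalIntegral.integral_sub
    (Continuous.intervalIntegrable (by fun_prop) _ _)
    (Continuous.intervalIntegrable (by fun_prop) _ _), ← intervalIntegral.integral_const_mul]
  refine (intervalIntegral.abs_integral_le_integral_abs hL).trans ?_
  refine intervalIntegral.integral_mono_on hL (Continuous.intervalIntegrable (by fun_prop) _ _)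
    (Continuous.intervalIntegrable (by fun_prop) _ _) fun y hy => ?_
  rw [← mul_sub, abs_mul, sub_sub_sub_cancel_left]
  refine mul_le_mul_of_nonneg_right ((hkL _ _).trans ?_) (abs_nonneg _)
  refine mul_le_mul_of_nonneg_left ?_ hB₁
  rw [show z - y - -y = z by ring, abs_of_nonneg hz.1]
  exact hz.2

/-- Ramps are mapped to ramps: the main term has slope `2m` and the integral costs at most `L B₁ ≤
m`. -/
theorem slope_profileMap (hL : 0 ≤ L) (hkc : Continuous (k μ))
    (hkL : ∀ x y, |k μ x - k μ y| ≤ B₁ * |x - y|) (hB₁ : 0 ≤ B₁) (hS : Continuous S)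
    (hSnn : ∀ u, 0 ≤ S u) (hSle : ∀ u, S u ≤ 1) (hv : Continuous v)
    (hLB : L * B₁ ≤ m) {x y : ℝ} (hxy : x ≤ y) (hΦ : 2 * m * (y - x) ≤ Φ μ y - Φ μ x) :
    m * (y - x) ≤ profileMap Φ k S θ L μ v y - profileMap Φ k S θ L μ v x := by
  have h1 : profileMap Φ k S θ L μ v y - profileMap Φ k S θ L μ v x = (Φ μ y - Φ μ x) -
      ∫ t in (0 : ℝ)..L, (k μ (y - t) - k μ (x - t)) * (1 - S (v t - θ)) := by
    unfold profileMap
    have h2 : ∫ t in (0 : ℝ)..L, (k μ (y - t) - k μ (x - t)) * (1 - S (v t - θ)) =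
        (∫ t in (0 : ℝ)..L, (k μ (y - t) - k μ (-t)) * (1 - S (v t - θ))) -
        ∫ t in (0 : ℝ)..L, (k μ (x - t) - k μ (-t)) * (1 - S (v t - θ)) := by
      rw [← intervalIntegral.integral_sub
        (Continuous.intervalIntegrable (by fun_prop) _ _)
        (Continuous.intervalIntegrable (by fun_prop) _ _)]
      exact intervalIntegral.integral_congr fun t _ => by ring
    rw [h2]; ring
  rw [h1]
  have h3 := intervalIntegral.norm_integral_le_of_norm_le_const (a := 0) (b := L)
    (f := fun t => (k μ (y - t) - k μ (x - t)) * (1 - S (v t - θ))) (C := B₁ * (y - x))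
    fun t _ => by
      rw [norm_mul]
      have h4 := hkL (y - t) (x - t)
      rw [sub_sub_sub_cancel_right, abs_of_nonneg (sub_nonneg.2 hxy)] at h4
      have h5 : |1 - S (v t - θ)| ≤ 1 := by
        rw [abs_of_nonneg (by linarith [hSle (v t - θ)])]
        linarith [hSnn (v t - θ)]
      calc _ ≤ B₁ * (y - x) * 1 := mul_le_mul h4 h5 (abs_nonneg _)
            (mul_nonneg hB₁ (sub_nonneg.2 hxy))
        _ = _ := mul_one _
  rw [sub_zero, abs_of_nonneg hL, Real.norm_eq_abs] at h3
  have h6 := (abs_le.1 h3).2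
  have h7 := mul_le_mul_of_nonneg_right hLB (sub_nonneg.2 hxy)
  linarith

/-- For a suitable speed, the profile equation near the threshold has a solution. -/
theorem exists_profile_fixedPoint (hL : 0 ≤ L) (hm : 0 < m) (hS : Monotone S) (hSc : Continuous S)
    (hS0 : ∀ u, u ≤ 0 → S u = 0) (hS1 : ∀ u, m * L ≤ u → S u = 1)
    (hSnn : ∀ u, 0 ≤ S u) (hSle : ∀ u, S u ≤ 1)
    (hΦ : Continuous fun q : ℝ × ℝ => Φ q.1 q.2) (hk : Continuous fun q : ℝ × ℝ => k q.1 q.2)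
    (hμ : μ₁ ≤ μ₂) (hB₁ : 0 ≤ B₁)
    (hΦm : ∀ μ ∈ Icc μ₁ μ₂, ∀ x y, 0 ≤ x → x ≤ y → y ≤ L → 2 * m * (y - x) ≤ Φ μ y - Φ μ x)
    (hkL : ∀ μ ∈ Icc μ₁ μ₂, ∀ x y, |k μ x - k μ y| ≤ B₁ * |x - y|)
    (hkB : ∀ μ x, |k μ x| ≤ B) (hLB : L * B₁ ≤ m / 4)
    (h₁ : θ ≤ Φ μ₁ 0 - B * L) (h₂ : Φ μ₂ 0 + B * L ≤ θ) :
    ∃ μ ∈ Icc μ₁ μ₂, ∃ v, IsRamp m L θ v ∧ ∀ z ∈ Icc 0 L,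
      v z = Φ μ z - ∫ y in (0 : ℝ)..L, k μ (z - y) * (1 - S (v y - θ)) := by
  have hkμ : ∀ μ, Continuous (k μ) := fun μ =>
    hk.comp (by fun_prop : Continuous fun x : ℝ => (μ, x))
  -- Ramps form a closed, nonempty set of continuous functions on `[0, L]`, hence a complete space;
  -- `IccExtend` supplies the constant continuations.
  let X : Set C(Icc 0 L, ℝ) := {u | IsRamp m L θ (IccExtend hL u)}
  have hXmem : ∀ u : C(Icc 0 L, ℝ), u ∈ X ↔ u ⟨0, le_rfl, hL⟩ = θ ∧
      ∀ x y : Icc 0 L, x ≤ y → m * (y - x) ≤ u y - u x := by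
    intro u
    constructor
    · intro hu
      refine ⟨?_, fun x y hxy => ?_⟩
      · rw [← hu.left 0 le_rfl]; exact (IccExtend_left hL u).symm
      · have := hu.slope x y x.2.1 hxy y.2.2
        simpa using this
    · rintro ⟨h0, hs⟩
      refine ⟨u.continuous.Icc_extend', fun x hx => ?_, fun x hx => ?_, fun x y hx hxy hy => ?_⟩
      · rw [IccExtend_of_le_left hL _ hx, ← h0]
      · rw [IccExtend_of_right_le hL _ hx, IccExtend_right]
      · rw [IccExtend_of_mem hL _ ⟨hx, hxy.trans hy⟩, IccExtend_of_mem hL _ ⟨hx.trans hxy, hy⟩]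
        exact hs ⟨x, hx, hxy.trans hy⟩ ⟨y, hx.trans hxy, hy⟩ hxy
  have hXclosed : IsClosed X := by
    have : X = {u | u ⟨0, le_rfl, hL⟩ = θ} ∩
        ⋂ (x : Icc 0 L) (y : Icc 0 L) (_ : x ≤ y), {u | m * (y - x) ≤ u y - u x} := by
      ext u
      simp only [hXmem, mem_inter_iff, mem_ofPred_eq, mem_iInter]
    rw [this]
    refine IsClosed.inter (isClosed_eq (ContinuousEvalConst.continuous_eval_const _) continuous_const) ?_
    refine isClosed_iInter fun x => isClosed_iInter fun y => isClosed_iInter fun _ => ?_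
    exact isClosed_le continuous_const ((ContinuousEvalConst.continuous_eval_const _).sub
      (ContinuousEvalConst.continuous_eval_const _))
  have : CompleteSpace X := hXclosed.completeSpace_coe
  have hne : Nonempty X := by
    refine ⟨⟨⟨fun x => θ + m * x, by fun_prop⟩, ?_⟩⟩
    rw [hXmem]
    refine ⟨by simp, fun x y _ => ?_⟩
    simp only [ContinuousMap.coe_mk]
    linarith
  let T : Icc μ₁ μ₂ → X → X := fun μ u =>
    ⟨⟨fun z => profileMap Φ k S θ L μ (IccExtend hL u.1) z,
      (continuous_profileMap hΦ hk hSc u.2.continuous).comp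
        (by fun_prop : Continuous fun z : Icc 0 L => ((μ : ℝ), (z : ℝ)))⟩, by
      rw [hXmem]
      refine ⟨profileMap_zero, fun x y hxy => ?_⟩
      exact slope_profileMap hL (hkμ _) (hkL μ μ.2) hB₁ hSc hSnn hSle u.2.continuous
        (by linarith) hxy (hΦm μ μ.2 x y x.2.1 hxy y.2.2)⟩
  have hT : ∀ μ, ContractingWith (1 / 2) (T μ) := by
    intro μ
    refine ⟨by norm_num, LipschitzWith.of_dist_le_mul fun u w => ?_⟩
    rw [Subtype.dist_eq, ContinuousMap.dist_le (by positivity)]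
    intro z
    rw [Real.dist_eq]
    refine (abs_profileMap_sub_le hL (hkμ μ) (hkL μ μ.2) hSc u.2.continuous w.2.continuous z.2
      hB₁).trans ?_
    have h1 := IsRamp.integral_abs_comp_sub_le hL hm hS hSc hS0 hS1 hSnn hSle u.2 w.2
      (dist_nonneg (x := u) (y := w)) (fun y _ => by
        rw [← Real.dist_eq]
        exact ContinuousMap.dist_apply_le_dist (f := u.1) (g := w.1) (projIcc 0 L hL y))
    -- The contraction constant `1/2` comes from `L B₁ ≤ m / 4` and the factor `2 / m` of the ramp
    -- estimate.
    have h2 : B₁ * L * (2 * (dist u w / m)) ≤ 1 / 2 * dist u w := by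
      have h3 : 2 * (L * B₁) / m ≤ 1 / 2 := by rw [div_le_iff₀ hm]; linarith
      calc _ = 2 * (L * B₁) / m * dist u w := by field_simp
        _ ≤ _ := mul_le_mul_of_nonneg_right h3 dist_nonneg
    refine (mul_le_mul_of_nonneg_left h1 (mul_nonneg hB₁ hL)).trans (h2.trans_eq ?_)
    norm_num
  have hTc : ∀ u, Continuous fun μ => T μ u := by
    intro u
    refine Continuous.subtype_mk ?_ _
    refine ContinuousMap.continuous_of_continuous_uncurry _ ?_
    exact (continuous_profileMap hΦ hk hSc u.2.continuous).comp
        (by fun_prop : Continuous fun q : Icc μ₁ μ₂ × Icc 0 L => ((q.1 : ℝ), (q.2 : ℝ)))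
  let V : Icc μ₁ μ₂ → X := fun μ => (hT μ).fixedPoint
  have hV : Continuous V := ContractingWith.continuous_fixedPoint_param hT hTc
  have hVfix : ∀ μ, T μ (V μ) = V μ := fun μ => (hT μ).fixedPoint_isFixedPt
  -- The value at `0` of the right-hand side without normalisation. The fixed point solves the
  -- original equation when `H μ = θ`.
  let H : Icc μ₁ μ₂ → ℝ := fun μ => Φ μ 0 -
    ∫ y in (0 : ℝ)..L, k μ (-y) * (1 - S (IccExtend hL (V μ).1 y - θ))
  have hH : Continuous H := by
    refine Continuous.sub (hΦ.comp
      (by fun_prop : Continuous fun μ : Icc μ₁ μ₂ => ((μ : ℝ), (0 : ℝ)))) ?_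
    refine intervalIntegral.continuous_parametric_intervalIntegral_of_continuous' ?_ _ _
    refine Continuous.mul (hk.comp (by fun_prop :
      Continuous fun q : Icc μ₁ μ₂ × ℝ => ((q.1 : ℝ), -q.2))) ?_
    refine continuous_const.sub (hSc.comp (Continuous.sub ?_ continuous_const))
    have hp : Continuous fun q : Icc μ₁ μ₂ × ℝ => projIcc 0 L hL q.2 :=
      continuous_projIcc.comp continuous_snd
    have hq : Continuous fun q : Icc μ₁ μ₂ × ℝ => (V q.1).1 :=
      continuous_subtype_val.comp (hV.comp continuous_fst)
    exact hq.eval hp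
  have hHbd : ∀ μ, |H μ - Φ μ 0| ≤ B * L := by
    intro μ
    simp only [H, sub_sub_cancel_left, abs_neg]
    have h3 := intervalIntegral.norm_integral_le_of_norm_le_const (a := 0) (b := L)
      (f := fun y => k μ (-y) * (1 - S (IccExtend hL (V μ).1 y - θ))) (C := B) fun t _ => by
        rw [norm_mul]
        have h5 : |1 - S (IccExtend hL (V μ).1 t - θ)| ≤ 1 := by
          rw [abs_of_nonneg (by linarith [hSle (IccExtend hL (V μ).1 t - θ)])]
          linarith [hSnn (IccExtend hL (V μ).1 t - θ)]
        calc _ ≤ B * 1 := mul_le_mul (hkB _ _) h5 (abs_nonneg _) ((abs_nonneg _).trans (hkB 0 0))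
          _ = _ := mul_one _
    rwa [sub_zero, abs_of_nonneg hL] at h3
  obtain ⟨μ, hμH⟩ : θ ∈ range H := by
    have : PreconnectedSpace (Icc μ₁ μ₂) := isPreconnected_iff_preconnectedSpace.1 isPreconnected_Icc
    refine intermediate_value_univ ⟨μ₂, hμ, le_rfl⟩ ⟨μ₁, le_rfl, hμ⟩ hH ⟨?_, ?_⟩
    · have := (abs_le.1 (hHbd ⟨μ₂, hμ, le_rfl⟩)).2
      dsimp only at this
      linarith
    · have := (abs_le.1 (hHbd ⟨μ₁, le_rfl, hμ⟩)).1
      dsimp only at this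
      linarith
  refine ⟨μ, μ.2, IccExtend hL (V μ).1, (V μ).2, fun z hz => ?_⟩
  have h1 : profileMap Φ k S θ L μ (IccExtend hL (V μ).1) z = IccExtend hL (V μ).1 z := by
    rw [IccExtend_of_mem hL _ hz]
    exact congrArg (fun u : X => u.1 ⟨z, hz⟩) (hVfix μ)
  have hc := (V μ).2.continuous
  have h2 : ∫ y in (0 : ℝ)..L, (k μ (z - y) - k μ (-y)) * (1 - S (IccExtend hL (V μ).1 y - θ)) =
      (∫ y in (0 : ℝ)..L, k μ (z - y) * (1 - S (IccExtend hL (V μ).1 y - θ))) -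
      ∫ y in (0 : ℝ)..L, k μ (-y) * (1 - S (IccExtend hL (V μ).1 y - θ)) := by
    have := hkμ μ
    rw [← intervalIntegral.integral_sub
        (Continuous.intervalIntegrable (by fun_prop) _ _)
        (Continuous.intervalIntegrable (by fun_prop) _ _)]
    exact intervalIntegral.integral_congr fun t _ => by ring
  rw [← h1, profileMap, h2]
  simp only [H] at hμH
  linarith

end profileMap

/-! ### Convolutions and their derivatives. -/

section convolution

variable {h f : ℝ → ℝ} {C : ℝ}

theorem integral_conv_comm (h f : ℝ → ℝ) (x : ℝ) :
    ∫ y, h (x - y) * f y = ∫ t, h t * f (x - t) := by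
  rw [← integral_sub_left_eq_self (fun t => h t * f (x - t)) volume x]
  simp

theorem tendsto_conv (hh : Integrable h) (hf : Continuous f) (hC : ∀ x, |f x| ≤ C) {ℓ : ℝ}
    {l : Filter ℝ} [l.IsCountablyGenerated] (hl : ∀ t, Tendsto (fun x => f (x - t)) l (𝓝 ℓ)) :
    Tendsto (fun x => ∫ y, h (x - y) * f y) l (𝓝 ((∫ t, h t) * ℓ)) := by
  simp only [integral_conv_comm]
  rw [← integral_mul_const]
  refine tendsto_integral_filter_of_dominated_convergence (fun t => |h t| * C) ?_ ?_ ?_ ?_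
  · exact Eventually.of_forall fun x => hh.aestronglyMeasurable.mul
      (by fun_prop : Continuous fun t => f (x - t)).aestronglyMeasurable
  · refine Eventually.of_forall fun x => Eventually.of_forall fun t => ?_
    rw [norm_mul]
    exact mul_le_mul_of_nonneg_left (hC _) (abs_nonneg _)
  · exact hh.abs.mul_const C
  · exact Eventually.of_forall fun t => (hl t).const_mul _

theorem continuous_conv (hh : Integrable h) (hf : Continuous f) (hC : ∀ x, |f x| ≤ C) :
    Continuous fun x => ∫ y, h (x - y) * f y := by
  refine continuous_iff_continuousAt.2 fun x => ?_
  simp only [ContinuousAt, integral_conv_comm]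
  refine tendsto_integral_filter_of_dominated_convergence (fun t => |h t| * C) ?_ ?_ ?_ ?_
  · exact Eventually.of_forall fun x => hh.aestronglyMeasurable.mul
      (by fun_prop : Continuous fun t => f (x - t)).aestronglyMeasurable
  · refine Eventually.of_forall fun x => Eventually.of_forall fun t => ?_
    rw [norm_mul]
    exact mul_le_mul_of_nonneg_left (hC _) (abs_nonneg _)
  · exact hh.abs.mul_const C
  · exact Eventually.of_forall fun t =>
      ((by fun_prop : Continuous fun x => h t * f (x - t)).tendsto x)

theorem integrable_conv (hh : Integrable h) (hf : Continuous f) (hC : ∀ x, |f x| ≤ C) (x : ℝ) :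
    Integrable fun y => h (x - y) * f y :=
  (hh.comp_sub_left x).mul_bdd (c := C) hf.aestronglyMeasurable
    (Eventually.of_forall fun y => hC y)

end convolution

theorem integral_comp_sub_Ioi_zero (K : ℝ → ℝ) (x : ℝ) :
    ∫ y in Ioi (0 : ℝ), K (x - y) = primitive K x := by
  rw [primitive, ← integral_indicator measurableSet_Iic, ← integral_indicator measurableSet_Ioi,
    ← integral_sub_left_eq_self (fun y => (Iic x).indicator K y) volume x]
  have h0 : ∀ᵐ s : ℝ, s ≠ 0 := by simp [ae_iff]
  refine integral_congr_ae ?_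
  filter_upwards [h0] with y hy
  have h1 : x - y ≤ x ↔ 0 < y :=
    (sub_le_self_iff x).trans ⟨fun h => h.lt_of_ne hy.symm, le_of_lt⟩
  simp [indicator, h1]

namespace IsLateralInhibitionKernel

variable {K : ℝ → ℝ} {M : ℝ}

theorem hasDerivAt (hK : IsLateralInhibitionKernel K M) {x : ℝ} (hx : x ≠ 0) :
    HasDerivAt K (deriv K x) x :=
  (((hK.smooth_off_zero.differentiableOn (by norm_num)) x hx).differentiableAt
    (isOpen_compl_singleton.mem_nhds hx)).hasDerivAt

theorem integral_deriv_eq (hK : IsLateralInhibitionKernel K M) (a b : ℝ) :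
    ∫ x in a..b, deriv K x = K b - K a :=
  integral_eq_of_hasDerivAt_off_countable K (deriv K) (countable_singleton 0)
    hK.continuous.continuousOn (fun _ hx => hK.hasDerivAt hx.2)
    hK.integrable_deriv.intervalIntegrable

theorem integral_deriv_eq_zero (hK : IsLateralInhibitionKernel K M) : ∫ x, deriv K x = 0 := by
  have h1 := intervalIntegral_tendsto_integral hK.integrable_deriv tendsto_neg_atTop_atBot
    tendsto_id
  have h2 : Tendsto (fun x : ℝ => ∫ t in (-x)..x, deriv K t) atTop (𝓝 0) := by
    simp [hK.integral_deriv_eq, hK.symmetric]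
  exact tendsto_nhds_unique h1 h2

/-- As `deriv K` is merely integrable, no dominating function for the difference quotients is at
hand. Instead the convolution is written, by Fubini, as an integral of the continuous function
`deriv K * f`, and then differentiated. -/
theorem hasDerivAt_conv (hK : IsLateralInhibitionKernel K M) {f : ℝ → ℝ} (hf : Continuous f)
    {C : ℝ} (hC : ∀ x, |f x| ≤ C) (x : ℝ) :
    HasDerivAt (fun x => ∫ y, K (x - y) * f y) (∫ y, deriv K (x - y) * f y) x := by
  have hD := continuous_conv hK.integrable_deriv hf hC
  have hmeas : Measurable (deriv K) := measurable_deriv K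
  have key : ∀ x, ∫ y, K (x - y) * f y = (∫ y, K (0 - y) * f y) +
      ∫ w in (0 : ℝ)..x, ∫ y, deriv K (w - y) * f y := by
    intro x
    have h1 : Integrable (fun q : ℝ × ℝ => deriv K (q.1 - q.2) * f q.2)
        ((volume.restrict (uIoc 0 x)).prod volume) := by
      refine Integrable.mul_bdd (c := C) ?_ (hf.comp continuous_snd).aestronglyMeasurable
        (Eventually.of_forall fun q => hC _)
      have hm : Measurable fun q : ℝ × ℝ => deriv K (q.1 - q.2) :=
        hmeas.comp (measurable_fst.sub measurable_snd)
      rw [integrable_prod_iff hm.aestronglyMeasurable]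
      refine ⟨Eventually.of_forall fun w => hK.integrable_deriv.comp_sub_left w, ?_⟩
      simp only [integral_sub_left_eq_self (fun y => ‖deriv K y‖)]
      exact intervalIntegrable_const.def'
    rw [intervalIntegral_integral_swap h1, ← sub_eq_iff_eq_add',
      ← integral_sub (integrable_conv hK.integrable hf hC x)
        (integrable_conv hK.integrable hf hC 0)]
    refine integral_congr_ae (Eventually.of_forall fun y => ?_)
    dsimp only
    rw [intervalIntegral.integral_mul_const, intervalIntegral.integral_comp_sub_right,
      hK.integral_deriv_eq]
    ring
  rw [show (fun x => ∫ y, K (x - y) * f y) = fun x => (∫ y, K (0 - y) * f y) +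
      ∫ w in (0 : ℝ)..x, ∫ y, deriv K (w - y) * f y from funext key]
  exact (intervalIntegral.integral_hasDerivAt_right (hD.intervalIntegrable _ _)
    (hD.stronglyMeasurableAtFilter _ _) hD.continuousAt).const_add _

/-- The input to the neural field from a firing pattern switching from `0` to `1` on `[0, L]`. -/
theorem integral_mul_eq_primitive_sub (hK : IsLateralInhibitionKernel K M) {f : ℝ → ℝ} {L : ℝ}
    (hf : Continuous f) (hL : 0 ≤ L) (h0 : ∀ y ≤ 0, f y = 0) (h1 : ∀ y, L ≤ y → f y = 1) (x : ℝ) :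
    ∫ y, K (x - y) * f y = primitive K x - ∫ y in (0 : ℝ)..L, K (x - y) * (1 - f y) := by
  have hKc := hK.continuous
  rw [intervalIntegral.integral_of_le hL, ← integral_comp_sub_Ioi_zero,
    ← integral_indicator measurableSet_Ioc, ← integral_indicator measurableSet_Ioi,
    ← integral_sub]
  · refine integral_congr_ae (Eventually.of_forall fun y => ?_)
    simp only [indicator, mem_Ioi, mem_Ioc]
    rcases le_or_gt y 0 with hy | hy
    · simp [h0 y hy, hy.not_gt]
    · rcases le_or_gt y L with hy2 | hy2
      · simp [hy, hy2]; ring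
      · simp [hy, hy2.not_ge, h1 y hy2.le]
  · exact (hK.integrable.comp_sub_left x).indicator measurableSet_Ioi
  · refine IntegrableOn.integrable_indicator ?_ measurableSet_Ioc
    exact ((by fun_prop : Continuous fun y => K (x - y) * (1 - f y)).integrableOn_Icc).mono_set
      Ioc_subset_Icc_self

end IsLateralInhibitionKernel

/-! ### Regularity, translates and limits of solutions. -/

theorem contDiff_two_of_hasDerivAt {U N D : ℝ → ℝ} {μ : ℝ}
    (hU : ∀ z, HasDerivAt U ((N z - U z) / μ) z) (hN : ∀ z, HasDerivAt N (D z) z)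
    (hD : Continuous D) : ContDiff ℝ 2 U ∧
      ∀ z, iteratedDeriv 2 U z = (D z - deriv U z) / μ := by
  have hd : deriv U = fun z => (N z - U z) / μ := funext fun z => (hU z).deriv
  have hd2 : ∀ z, HasDerivAt (deriv U) ((D z - deriv U z) / μ) z := by
    intro z
    rw [hd]
    exact ((hN z).sub (hU z)).div_const μ
  have hUd : Differentiable ℝ U := fun z => (hU z).differentiableAt
  have hUc : Continuous (deriv U) := continuous_iff_continuousAt.2 fun z => (hd2 z).continuousAt
  refine ⟨?_, fun z => ?_⟩
  · rw [show (2 : WithTop ℕ∞) = 1 + 1 by norm_num, contDiff_succ_iff_deriv]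
    refine ⟨hUd, by simp, ?_⟩
    rw [contDiff_one_iff_deriv]
    refine ⟨fun z => (hd2 z).differentiableAt, ?_⟩
    rw [show deriv (deriv U) = fun z => (D z - deriv U z) / μ from funext fun z => (hd2 z).deriv]
    exact (hD.sub hUc).div_const μ
  · rw [iteratedDeriv_succ, iteratedDeriv_one]
    exact (hd2 z).deriv

theorem SolvesFrontEq.comp_add_right {K S U : ℝ → ℝ} {θ μ : ℝ} (h : SolvesFrontEq K S θ μ U)
    (c : ℝ) : SolvesFrontEq K S θ μ (fun z => U (z + c)) := by
  refine ⟨h.1.comp (differentiable_id.add_const c), fun z => ?_⟩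
  rw [deriv_comp_add_const, h.2 (z + c),
    ← integral_add_right_eq_self (fun y => K (z + c - y) * S (U y - θ)) c]
  simp

theorem SolvesFrontEq.solvesNeuralField {K S U : ℝ → ℝ} {θ μ : ℝ} (h : SolvesFrontEq K S θ μ U) :
    SolvesNeuralField K S θ (fun x t => U (x + μ * t)) := by
  intro x t
  have h1 := (h.comp_add_right (μ * t)).2 x
  rw [deriv_comp_add_const] at h1
  dsimp only at h1
  rw [← h1]
  have h2 : HasDerivAt (fun s : ℝ => x + μ * s) μ t := by
    simpa using ((hasDerivAt_id t).const_mul μ).const_add x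
  refine ((h.1 (x + μ * t)).hasDerivAt.comp t h2).congr_deriv ?_
  ring

/-- The regularity and the limits asserted of the fronts. -/
theorem SolvesFrontEq.regularity {K S U N D : ℝ → ℝ} {θ μ : ℝ} (hμ : 0 < μ)
    (h : SolvesFrontEq K S θ μ U) (hSN : ∀ z, ∫ y, K (z - y) * S (U y - θ) = N z)
    (hN : ∀ z, HasDerivAt N (D z) z) (hD : Continuous D)
    (hN0 : Tendsto N atBot (𝓝 0)) (hN1 : Tendsto N atTop (𝓝 1))
    (hU0 : Tendsto U atBot (𝓝 0)) (hU1 : Tendsto U atTop (𝓝 1))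
    (hD0 : Tendsto D atBot (𝓝 0)) (hD1 : Tendsto D atTop (𝓝 0)) :
    ContDiff ℝ 2 U ∧ Tendsto (deriv U) atBot (𝓝 0) ∧ Tendsto (deriv U) atTop (𝓝 0) ∧
      Tendsto (iteratedDeriv 2 U) atBot (𝓝 0) ∧ Tendsto (iteratedDeriv 2 U) atTop (𝓝 0) := by
  have hd : ∀ z, deriv U z = (N z - U z) / μ := fun z => by
    rw [eq_div_iff hμ.ne', ← hSN, ← h.2]; ring
  have hU : ∀ z, HasDerivAt U ((N z - U z) / μ) z := fun z => hd z ▸ (h.1 z).hasDerivAt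
  obtain ⟨hc, h2⟩ := contDiff_two_of_hasDerivAt hU hN hD
  have e1 : deriv U = fun z => (N z - U z) / μ := funext hd
  have e2 : iteratedDeriv 2 U = fun z => (D z - deriv U z) / μ := funext h2
  have l0 : Tendsto (deriv U) atBot (𝓝 0) := by
    rw [e1]; simpa using (hN0.sub hU0).div_const μ
  have l1 : Tendsto (deriv U) atTop (𝓝 0) := by
    rw [e1]; simpa using (hN1.sub hU1).div_const μ
  refine ⟨hc, l0, l1, ?_, ?_⟩
  · rw [e2]; simpa using (hD0.sub l0).div_const μ
  · rw [e2]; simpa using (hD1.sub l1).div_const μ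

theorem hasDerivAt_intervalIntegral_comp_sub {k k' e : ℝ → ℝ} {L B : ℝ}
    (hk : ∀ x, HasDerivAt k (k' x) x) (hk' : Continuous k') (hB : ∀ x, |k' x| ≤ B)
    (he : Continuous e) (hnn : ∀ y, |e y| ≤ 1) (z : ℝ) :
    HasDerivAt (fun z => ∫ y in (0 : ℝ)..L, k (z - y) * e y)
      (∫ y in (0 : ℝ)..L, k' (z - y) * e y) z := by
  have hkc : Continuous k := continuous_iff_continuousAt.2 fun x => (hk x).continuousAt
  refine (intervalIntegral.hasDerivAt_integral_of_dominated_loc_of_deriv_le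
    (F := fun z y => k (z - y) * e y) (F' := fun z y => k' (z - y) * e y) (s := univ)
    (bound := fun _ => B) univ_mem ?_ ?_ ?_ ?_ ?_ ?_).2
  · exact Eventually.of_forall fun x => (by fun_prop : Continuous fun y =>
      k (x - y) * e y).aestronglyMeasurable
  · exact Continuous.intervalIntegrable (by fun_prop) _ _
  · exact (by fun_prop : Continuous fun y => k' (z - y) * e y).aestronglyMeasurable
  · refine Eventually.of_forall fun y _ x _ => ?_
    rw [norm_mul]
    exact (mul_le_mul (hB _) (hnn _) (abs_nonneg _) ((abs_nonneg _).trans (hB 0))).trans_eq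
      (mul_one _)
  · simp
  · refine Eventually.of_forall fun y _ x _ => ?_
    exact ((hk (x - y)).comp_sub_const x y).mul_const _

theorem tendsto_intervalIntegral_comp_sub {k e : ℝ → ℝ} {L B : ℝ} (hk : Continuous k)
    (hB : ∀ x, |k x| ≤ B) (he : Continuous e) (hnn : ∀ y, |e y| ≤ 1) {l : Filter ℝ}
    [l.IsCountablyGenerated] (hl : ∀ t, Tendsto (fun x => k (x - t)) l (𝓝 0)) :
    Tendsto (fun z => ∫ y in (0 : ℝ)..L, k (z - y) * e y) l (𝓝 0) := by
  suffices h : Tendsto (fun z => ∫ y in (0 : ℝ)..L, k (z - y) * e y) l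
      (𝓝 (∫ y in (0 : ℝ)..L, 0 * e y)) by simpa using h
  refine intervalIntegral.tendsto_integral_filter_of_dominated_convergence
    (l := l) (fun _ => B) ?_ ?_ ?_ ?_
  · exact Eventually.of_forall fun x => (by fun_prop : Continuous fun y =>
      k (x - y) * e y).aestronglyMeasurable
  · refine Eventually.of_forall fun x => Eventually.of_forall fun y _ => ?_
    rw [norm_mul]
    exact (mul_le_mul (hB _) (hnn _) (abs_nonneg _) ((abs_nonneg _).trans (hB 0))).trans_eq
      (mul_one _)
  · simp
  · exact Eventually.of_forall fun y _ => (hl y).mul_const _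

theorem abs_intervalIntegral_mul_le {k e : ℝ → ℝ} {L B : ℝ} (hL : 0 ≤ L) (hB : ∀ x, |k x| ≤ B)
    (hnn : ∀ y, |e y| ≤ 1) : |∫ y in (0 : ℝ)..L, k y * e y| ≤ B * L := by
  have h3 := intervalIntegral.norm_integral_le_of_norm_le_const (a := 0) (b := L)
    (f := fun y => k y * e y) (C := B) fun t _ => by
      rw [norm_mul]
      exact (mul_le_mul (hB _) (hnn _) (abs_nonneg _) ((abs_nonneg _).trans (hB 0))).trans_eq
        (mul_one _)
  rwa [sub_zero, abs_of_nonneg hL] at h3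

/-! ### Global properties of the firing rates and of the Heaviside front. -/

namespace IsSmoothHeavisideFamily

variable {S : ℝ → ℝ → ℝ} {τ : ℝ}

theorem monotone (hS : IsSmoothHeavisideFamily S) (hτ : 0 < τ) : Monotone (S τ) := by
  have hproj : ∀ u, S τ u = S τ (max 0 (min u τ)) := by
    intro u
    rcases le_total u 0 with h | h
    · rw [min_eq_left (h.trans hτ.le), max_eq_left h, hS.eq_zero τ hτ u h, hS.eq_zero τ hτ 0 le_rfl]
    · rcases le_total u τ with h2 | h2
      · rw [min_eq_left h2, max_eq_right h]
      · rw [min_eq_right h2, max_eq_right hτ.le, hS.eq_one τ hτ u h2, hS.eq_one τ hτ τ le_rfl]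
  intro a b hab
  rw [hproj a, hproj b]
  have hmem : ∀ u, max 0 (min u τ) ∈ Icc 0 τ := fun u =>
    ⟨le_max_left _ _, max_le hτ.le (min_le_right _ _)⟩
  exact hS.increasing τ hτ (hmem a) (hmem b) (max_le_max le_rfl (min_le_min hab le_rfl))

theorem nonneg (hS : IsSmoothHeavisideFamily S) (hτ : 0 < τ) (u : ℝ) : 0 ≤ S τ u := by
  rw [← hS.eq_zero τ hτ (min u 0) (min_le_right _ _)]
  exact hS.monotone hτ (min_le_left _ _)

theorem le_one (hS : IsSmoothHeavisideFamily S) (hτ : 0 < τ) (u : ℝ) : S τ u ≤ 1 := by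
  rw [← hS.eq_one τ hτ (max u τ) (le_max_right _ _)]
  exact hS.monotone hτ (le_max_left _ _)

end IsSmoothHeavisideFamily

/-- Compactness on a bounded interval and the limit beyond it. The resulting uniform gap keeps a
uniformly close profile away from the threshold far from `0`. -/
theorem Continuous.exists_gap_of_tendsto_atTop {g : ℝ → ℝ} {r c ℓ : ℝ} (hg : Continuous g)
    (hc : ∀ z, r ≤ z → c < g z) (hl : Tendsto g atTop (𝓝 ℓ)) (hℓ : c < ℓ) :
    ∃ η, 0 < η ∧ ∀ z, r ≤ z → c + η ≤ g z := by
  obtain ⟨R, hR⟩ := eventually_atTop.1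
    (hl.eventually_const_le (show (c + ℓ) / 2 < ℓ by linarith))
  obtain ⟨x, hx, hmin⟩ := isCompact_Icc.exists_isMinOn (s := Icc r (max r R))
    ⟨r, le_rfl, le_max_left _ _⟩ hg.continuousOn
  refine ⟨min ((ℓ - c) / 2) (g x - c), lt_min (by linarith) (sub_pos.2 (hc x hx.1)),
    fun z hz => ?_⟩
  rcases le_total z R with h | h
  · have := hmin (show z ∈ Icc r (max r R) from ⟨hz, h.trans (le_max_right _ _)⟩)
    have h2 := min_le_right ((ℓ - c) / 2) (g x - c)
    simp only [mem_ofPred_eq] at this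
    linarith
  · have := hR z h
    have h2 := min_le_left ((ℓ - c) / 2) (g x - c)
    linarith

namespace IsHeavisideFront

variable {K : ℝ → ℝ} {M θ : ℝ} {S U₀ : ℝ → ℝ} {μ₀ : ℝ}

theorem integral_eq (hU₀ : IsHeavisideFront K S θ U₀ μ₀) (hneg : ∀ u, u < 0 → S u = 0)
    (hpos : ∀ u, 0 < u → S u = 1) (z : ℝ) :
    ∫ y, K (z - y) * S (U₀ y - θ) = primitive K z := by
  rw [← integral_comp_sub_Ioi_zero, ← integral_indicator measurableSet_Ioi]
  have h0 : ∀ᵐ s : ℝ, s ≠ 0 := by simp [ae_iff]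
  refine integral_congr_ae ?_
  filter_upwards [h0] with y hy
  rcases lt_or_gt_of_ne hy with h | h
  · simp [indicator, h.not_gt, hneg _ (sub_neg.2 (hU₀.below y h))]
  · simp [indicator, h, hpos _ (sub_pos.2 (hU₀.above y h))]

theorem hasDerivAt (hU₀ : IsHeavisideFront K S θ U₀ μ₀) (hneg : ∀ u, u < 0 → S u = 0)
    (hpos : ∀ u, 0 < u → S u = 1) (z : ℝ) :
    HasDerivAt U₀ ((primitive K z - U₀ z) / μ₀) z := by
  have h := hU₀.solves.2 z
  rw [hU₀.integral_eq hneg hpos] at h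
  have h2 : deriv U₀ z = (primitive K z - U₀ z) / μ₀ := by
    rw [eq_div_iff hU₀.speed_pos.ne', ← h]; ring
  exact h2 ▸ (hU₀.solves.1 z).hasDerivAt

theorem eq_expAvg (hK : IsLateralInhibitionKernel K M) (hU₀ : IsHeavisideFront K S θ U₀ μ₀)
    (hneg : ∀ u, u < 0 → S u = 0) (hpos : ∀ u, 0 < u → S u = 1) :
    U₀ = expAvg (primitive K) μ₀ :=
  eq_expAvg_of_hasDerivAt hK.continuous_primitive hK.abs_primitive_le hU₀.speed_pos
    hK.tendsto_primitive_atBot (hU₀.hasDerivAt hneg hpos) hU₀.lim_bot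

theorem hypothesisH1 (hK : IsLateralInhibitionKernel K M) (hU₀ : IsHeavisideFront K S θ U₀ μ₀)
    (hθ0 : 0 ≤ θ) (hθ1 : θ < 1) : HypothesisH1 K M θ 0 U₀ := by
  have h0 : ∀ z, U₀ z = θ → z = 0 := by
    intro z hz
    rcases lt_trichotomy z 0 with h | h | h
    · exact absurd hz (hU₀.below z h).ne
    · exact h
    · exact absurd hz (hU₀.above z h).ne'
  rw [HypothesisH1, add_zero, Icc_self]
  obtain ⟨σ₁, h₁⟩ := hK.exists_isSigma1
  obtain ⟨σ₂, h₂⟩ := hK.exists_isSigma2 hθ0 hθ1.le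
  obtain ⟨σ₃, h₃⟩ := hK.exists_isSigma3 hθ0 hθ1.le
  refine ⟨hθ1, ?_, ?_, σ₁, σ₂, σ₃, h₁, h₂, h₃, ?_⟩
  · rintro v rfl
    exact ⟨0, hU₀.at_zero, hU₀.below, hU₀.above⟩
  · intro z hz
    rw [h0 z hz]
    exact hU₀.deriv_pos
  · intro a b ha hb
    rw [h0 a ha, h0 b hb, sub_zero]
    exact le_min h₁.1.le (le_min h₂.1.le h₃.1.le)

end IsHeavisideFront

/-! ### Profiles with a prescribed firing pattern. -/

/-- The solution, for a given speed, of the profile equation whose firing pattern `1 - e` switches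
from `0` to `1` on `[0, L]`. -/
noncomputable def profile (K e : ℝ → ℝ) (L μ z : ℝ) : ℝ :=
  expAvg (primitive K) μ z - ∫ y in (0 : ℝ)..L, expAvg K μ (z - y) * e y

section profile

variable {K : ℝ → ℝ} {M : ℝ} {e : ℝ → ℝ} {L μ : ℝ}

theorem abs_deriv_expAvg_le {g : ℝ → ℝ} {B : ℝ} (hB : ∀ x, |g x| ≤ B) (hμ : 0 < μ) (z : ℝ) :
    |(g z - expAvg g μ z) / μ| ≤ 2 * B / μ := by
  rw [abs_div, abs_of_pos hμ]
  refine div_le_div_of_nonneg_right ((abs_sub _ _).trans ?_) hμ.le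
  linarith [hB z, abs_expAvg_le hB μ z]

theorem continuous_expAvg_right {g : ℝ → ℝ} (hg : Continuous g) {C : ℝ} (hC : ∀ x, |g x| ≤ C)
    (μ : ℝ) : Continuous (expAvg g μ) :=
  (continuous_expAvg hg hC).comp (by fun_prop : Continuous fun z : ℝ => (μ, z))

theorem hasDerivAt_profile (hK : IsLateralInhibitionKernel K M) (he : Continuous e)
    (he1 : ∀ y, |e y| ≤ 1) (hμ : 0 < μ) (z : ℝ) :
    HasDerivAt (profile K e L μ) ((primitive K z - expAvg (primitive K) μ z) / μ -
      ∫ y in (0 : ℝ)..L, (K (z - y) - expAvg K μ (z - y)) / μ * e y) z := by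
  obtain ⟨B, -, hB⟩ := hK.exists_bound
  refine (hasDerivAt_expAvg hK.continuous_primitive hK.abs_primitive_le hμ z).sub ?_
  exact hasDerivAt_intervalIntegral_comp_sub (hasDerivAt_expAvg hK.continuous hB hμ)
    ((hK.continuous.sub (continuous_expAvg_right hK.continuous hB μ)).div_const μ)
    (abs_deriv_expAvg_le hB hμ) he he1 z

theorem profile_eq (hK : IsLateralInhibitionKernel K M) (he : Continuous e)
    (he1 : ∀ y, |e y| ≤ 1) (hμ : 0 < μ) (z : ℝ) :
    μ * deriv (profile K e L μ) z + profile K e L μ z =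
      primitive K z - ∫ y in (0 : ℝ)..L, K (z - y) * e y := by
  obtain ⟨B, -, hB⟩ := hK.exists_bound
  have hKc := hK.continuous
  have hkc := continuous_expAvg_right hKc hB μ
  rw [(hasDerivAt_profile hK he he1 hμ z).deriv, profile]
  have h1 : ∫ y in (0 : ℝ)..L, (K (z - y) - expAvg K μ (z - y)) / μ * e y =
      ((∫ y in (0 : ℝ)..L, K (z - y) * e y) - ∫ y in (0 : ℝ)..L, expAvg K μ (z - y) * e y) / μ := by
    rw [← intervalIntegral.integral_sub (Continuous.intervalIntegrable (by fun_prop) _ _)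
      (Continuous.intervalIntegrable (by fun_prop) _ _), ← intervalIntegral.integral_div]
    exact intervalIntegral.integral_congr fun y _ => by ring
  rw [h1]
  field_simp
  ring

theorem tendsto_profile (hK : IsLateralInhibitionKernel K M) (he : Continuous e)
    (he1 : ∀ y, |e y| ≤ 1) (μ : ℝ) (L : ℝ) :
    Tendsto (profile K e L μ) atBot (𝓝 0) ∧ Tendsto (profile K e L μ) atTop (𝓝 1) := by
  obtain ⟨B, -, hB⟩ := hK.exists_bound
  have hKc := hK.continuous
  have hkc := continuous_expAvg_right hKc hB μ
  have sT : ∀ s : ℝ, Tendsto (fun z : ℝ => z - s) atTop atTop := fun s =>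
    tendsto_atTop_add_const_right _ _ tendsto_id
  have sB : ∀ s : ℝ, Tendsto (fun z : ℝ => z - s) atBot atBot := fun s =>
    tendsto_atBot_add_const_right _ _ tendsto_id
  constructor
  · have h1 := tendsto_expAvg (μ := μ) hK.continuous_primitive hK.abs_primitive_le
      fun s => hK.tendsto_primitive_atBot.comp (sB (μ * s))
    have h2 := tendsto_intervalIntegral_comp_sub (L := L) hkc (abs_expAvg_le hB μ) he he1
      fun t => (tendsto_expAvg (μ := μ) hKc hB fun s =>
        hK.tendsto_atBot.comp (sB (μ * s))).comp (sB t)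
    have h3 := h1.sub h2
    rw [sub_zero] at h3
    exact h3
  · have h1 := tendsto_expAvg (μ := μ) hK.continuous_primitive hK.abs_primitive_le
      fun s => hK.tendsto_primitive_atTop.comp (sT (μ * s))
    have h2 := tendsto_intervalIntegral_comp_sub (L := L) hkc (abs_expAvg_le hB μ) he he1
      fun t => (tendsto_expAvg (μ := μ) hKc hB fun s =>
        hK.tendsto_atTop.comp (sT (μ * s))).comp (sT t)
    have h3 := h1.sub h2
    rw [sub_zero] at h3
    exact h3

end profile

/-- The properties asserted of a front with firing rate `S`. -/
def IsRegularFront (K : ℝ → ℝ) (M θ τ : ℝ) (S U : ℝ → ℝ) (μ : ℝ) : Prop :=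
  ContDiff ℝ 2 U ∧ 0 < μ ∧ SolvesFrontEq K S θ μ U ∧
    (∀ c : ℝ, SolvesFrontEq K S θ μ (fun z => U (z + c))) ∧
    SolvesNeuralField K S θ (fun x t => U (x + μ * t)) ∧
    HypothesisH1 K M θ τ U ∧
    Tendsto U atBot (𝓝 0) ∧ Tendsto U atTop (𝓝 1) ∧
    Tendsto (deriv U) atBot (𝓝 0) ∧ Tendsto (deriv U) atTop (𝓝 0) ∧
    Tendsto (iteratedDeriv 2 U) atBot (𝓝 0) ∧ Tendsto (iteratedDeriv 2 U) atTop (𝓝 0)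

theorem IsHeavisideFront.isRegularFront {K : ℝ → ℝ} {M θ : ℝ} {S U₀ : ℝ → ℝ} {μ₀ : ℝ}
    (hK : IsLateralInhibitionKernel K M) (hU₀ : IsHeavisideFront K S θ U₀ μ₀)
    (hθ0 : 0 ≤ θ) (hθ1 : θ < 1) (hneg : ∀ u, u < 0 → S u = 0) (hpos : ∀ u, 0 < u → S u = 1) :
    IsRegularFront K M θ 0 S U₀ μ₀ := by
  obtain ⟨hc, l1, l2, l3, l4⟩ := hU₀.solves.regularity hU₀.speed_pos
    (hU₀.integral_eq hneg hpos) hK.hasDerivAt_primitive hK.continuous hK.tendsto_primitive_atBot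
    hK.tendsto_primitive_atTop hU₀.lim_bot hU₀.lim_top hK.tendsto_atBot hK.tendsto_atTop
  exact ⟨hc, hU₀.speed_pos, hU₀.solves, hU₀.solves.comp_add_right, hU₀.solves.solvesNeuralField,
    hU₀.hypothesisH1 hK hθ0 hθ1, hU₀.lim_bot, hU₀.lim_top, l1, l2, l3, l4⟩

/-! ### Verification of `H₁` and construction of the fronts. -/

/-- A profile which is close to a Heaviside front and steep near the threshold satisfies `H₁`. -/
theorem hypothesisH1_of_slope {K : ℝ → ℝ} {M θ τ L r s : ℝ} {U : ℝ → ℝ}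
    (hK : IsLateralInhibitionKernel K M) (hU : Differentiable ℝ U) (hθ0 : 0 ≤ θ) (hτ : 0 ≤ τ)
    (hθτ : θ + τ < 1) (hL : 0 ≤ L) (hLr : L < r) (h0 : U 0 = θ) (hUL : θ + τ ≤ U L)
    (hd : ∀ z ∈ Icc (-r) r, 0 < deriv U z) (hl : ∀ z, z ≤ -r → U z < θ)
    (hr : ∀ z, r ≤ z → θ + τ < U z) (hs1 : ∀ σ, IsSigma1 K σ → s ≤ σ)
    (hs3 : ∀ v, v ≤ 1 → ∀ σ, IsSigma3 K M v σ → s ≤ σ) (hLs : L ≤ s) :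
    HypothesisH1 K M θ τ U ∧ ∀ z, (z < 0 → U z < θ) ∧ (L < z → θ + τ < U z) := by
  have hmono : StrictMonoOn U (Icc (-r) r) := by
    refine strictMonoOn_of_deriv_pos (convex_Icc _ _) hU.continuous.continuousOn fun z hz => ?_
    exact hd z (interior_subset hz)
  have hcross : ∀ z ∈ Icc 0 L, U z ∈ Icc θ (θ + τ) → CrossesOnceAt U (U z) z := by
    intro z hz hv
    have hzr : z ∈ Icc (-r) r := ⟨by linarith [hz.1], by linarith [hz.2]⟩
    refine ⟨rfl, fun y hy => ?_, fun y hy => ?_⟩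
    · rcases le_total y (-r) with h | h
      · exact (hl y h).trans_le hv.1
      · exact hmono ⟨h, by linarith [hzr.2]⟩ hzr hy
    · rcases le_total r y with h | h
      · exact hv.2.trans_lt (hr y h)
      · exact hmono hzr ⟨by linarith [hzr.1], h⟩ hy
  have hex : ∀ v ∈ Icc θ (θ + τ), ∃ z ∈ Icc 0 L, U z = v := fun v hv =>
    intermediate_value_Icc hL hU.continuous.continuousOn
      ⟨h0.trans_le hv.1, hv.2.trans hUL⟩
  have c0 := hcross 0 ⟨le_rfl, hL⟩ (by rw [h0]; exact ⟨le_rfl, by linarith⟩)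
  rw [h0] at c0
  obtain ⟨b₀, hb₀, hb₀v⟩ := hex (θ + τ) ⟨by linarith, le_rfl⟩
  have c1 := hcross b₀ hb₀ (by rw [hb₀v]; exact ⟨by linarith, le_rfl⟩)
  rw [hb₀v] at c1
  obtain ⟨σ₁, h₁⟩ := hK.exists_isSigma1
  obtain ⟨σ₂, h₂⟩ := hK.exists_isSigma2 hθ0 (by linarith : θ ≤ 1)
  obtain ⟨σ₃, h₃⟩ := hK.exists_isSigma3 (v := θ + τ) (by linarith) hθτ.le
  refine ⟨⟨hθτ, ?_, ?_, σ₁, σ₂, σ₃, h₁, h₂, h₃, ?_⟩, fun z => ⟨c0.2.1 z, fun h =>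
    c1.2.2 z (hb₀.2.trans_lt h)⟩⟩
  · intro v hv
    obtain ⟨z, hz, rfl⟩ := hex v hv
    exact ⟨z, hcross z hz hv⟩
  · intro z hz
    refine hd z ⟨?_, ?_⟩
    · by_contra h
      exact (hl z (not_le.1 h).le).not_ge hz.1
    · by_contra h
      exact (hr z (not_le.1 h).le).not_ge hz.2
  · intro a b ha hb
    have ha0 : 0 ≤ a := by
      by_contra h
      exact (c0.2.1 a (not_le.1 h)).ne ha
    have hbL : b ≤ L := by
      by_contra h
      exact (c1.2.2 b (hb₀.2.trans_lt (not_le.1 h))).ne' hb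
    have hLσ : L ≤ min σ₁ (min σ₂ σ₃) := hLs.trans
      (le_min (hs1 _ h₁) (le_min (hs3 _ (by linarith) _ (hK.isSigma2_iff.1 h₂))
        (hs3 _ hθτ.le _ h₃)))
    linarith

/-- Perturbation of a Heaviside front whose ingredients are quantitatively controlled. -/
theorem exists_isRegularFront {K : ℝ → ℝ} {M θ τ m r η B μ₀ μ₁ μ₂ b s : ℝ} {S : ℝ → ℝ}
    (hK : IsLateralInhibitionKernel K M) (hB : ∀ x, |K x| ≤ B) (hθ0 : 0 ≤ θ)
    (hτ : 0 < τ) (hθτ : θ + τ < 1) (hm : 0 < m)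
    (hS : Monotone S) (hSc : Continuous S)
    (hS0 : ∀ u, u ≤ 0 → S u = 0) (hS1 : ∀ u, τ ≤ u → S u = 1)
    (hSnn : ∀ u, 0 ≤ S u) (hSle : ∀ u, S u ≤ 1)
    (hb : 0 < b) (hbμ : b ≤ μ₁) (hμ : μ₁ ≤ μ₂)
    (hslope : ∀ μ ∈ Icc μ₁ μ₂, ∀ z ∈ Icc (-r) r,
      2 * m ≤ (primitive K z - expAvg (primitive K) μ z) / μ)
    (hclose : ∀ μ ∈ Icc μ₁ μ₂, B * |μ - μ₀| ≤ η / 2)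
    (hl : ∀ z, z ≤ -r → expAvg (primitive K) μ₀ z + 2 * η ≤ θ)
    (hr : ∀ z, r ≤ z → θ + 2 * η ≤ expAvg (primitive K) μ₀ z)
    (h₁ : θ ≤ expAvg (primitive K) μ₁ 0 - B * (τ / m))
    (h₂ : expAvg (primitive K) μ₂ 0 + B * (τ / m) ≤ θ)
    (hLB : τ / m * (2 * B / b) ≤ m / 4) (hLη : B * (τ / m) ≤ η / 2) (hLr : τ / m < r)
    (hτη : τ < η) (hs1 : ∀ σ, IsSigma1 K σ → s ≤ σ)
    (hs3 : ∀ v, v ≤ 1 → ∀ σ, IsSigma3 K M v σ → s ≤ σ) (hLs : τ / m ≤ s) :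
    ∃ (U : ℝ → ℝ) (μ : ℝ), IsRegularFront K M θ τ S U μ := by
  -- A ramp of slope `m` climbs by `τ` over this length, so the firing rate saturates at `L`.
  set L := τ / m with hLdef
  have hL : 0 ≤ L := by positivity
  have hmL : m * L = τ := by rw [hLdef]; field_simp
  have hB0 : 0 ≤ B := (abs_nonneg _).trans (hB 0)
  have hKc := hK.continuous
  have hWc := hK.continuous_primitive
  have hWB := hK.abs_primitive_le
  have hpos : ∀ μ ∈ Icc μ₁ μ₂, 0 < μ := fun μ h => hb.trans_le (hbμ.trans h.1)
  have hB₁ : ∀ μ ∈ Icc μ₁ μ₂, 2 * B / μ ≤ 2 * B / b := fun μ h =>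
    div_le_div_of_nonneg_left (by linarith) hb (hbμ.trans h.1)
  obtain ⟨μ, hμI, v, hv, hvz⟩ := exists_profile_fixedPoint (Φ := expAvg (primitive K))
    (k := expAvg K) (S := S) (m := m) (L := L) (θ := θ) (B := B) (B₁ := 2 * B / b)
    hL hm hS hSc hS0 (by rwa [hmL]) hSnn hSle (continuous_expAvg hWc hWB)
    (continuous_expAvg hKc hB) hμ (by positivity)
    (fun μ hμI x y hx hxy hy => by
      refine Convex.mul_sub_le_image_sub_of_le_deriv (convex_Icc 0 L)
        (continuous_expAvg_right hWc hWB μ).continuousOn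
        (fun z _ => (hasDerivAt_expAvg hWc hWB (hpos μ hμI) z).differentiableAt.differentiableWithinAt)
        (fun z hz => ?_) x ⟨hx, hxy.trans hy⟩ y ⟨hx.trans hxy, hy⟩ hxy
      have hz' := interior_subset hz
      rw [(hasDerivAt_expAvg hWc hWB (hpos μ hμI) z).deriv]
      exact hslope μ hμI z ⟨by linarith [hz'.1], by linarith [hz'.2]⟩)
    (fun μ hμI x y => by
      have h := Convex.norm_image_sub_le_of_norm_hasDerivWithin_le (s := univ)
        (fun z _ => (hasDerivAt_expAvg hKc hB (hpos μ hμI) z).hasDerivWithinAt)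
        (fun z _ => (abs_deriv_expAvg_le hB (hpos μ hμI) z).trans (hB₁ μ hμI)) convex_univ
        (mem_univ y) (mem_univ x)
      exact h)
    (fun μ x => abs_expAvg_le hB μ x) hLB h₁ h₂
  have hμ0 := hpos μ hμI
  set e : ℝ → ℝ := fun y => 1 - S (v y - θ) with he
  have hvc := hv.continuous
  have hec : Continuous e := by fun_prop
  have he1 : ∀ y, |e y| ≤ 1 := fun y => by
    rw [abs_of_nonneg (by linarith [hSle (v y - θ)])]
    linarith [hSnn (v y - θ)]
  -- The fixed point is known only on `[0, L]`; the formula extends it to the line with the firing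
  -- pattern of `v`.
  set U := profile K e L μ with hU
  have hUd : Differentiable ℝ U := fun z =>
    (hasDerivAt_profile hK hec he1 hμ0 z).differentiableAt
  have hUv : ∀ z ∈ Icc 0 L, U z = v z := fun z hz => (hvz z hz).symm
  have h0 : U 0 = θ := by rw [hUv 0 ⟨le_rfl, hL⟩, hv.left 0 le_rfl]
  have hUL : θ + τ ≤ U L := by
    rw [hUv L ⟨hL, le_rfl⟩, ← hmL]
    exact hv.le_right hL le_rfl
  -- The main term contributes at least `2m`, and the correction takes away at most `m / 4`.
  have hd : ∀ z ∈ Icc (-r) r, 0 < deriv U z := by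
    intro z hz
    rw [(hasDerivAt_profile hK hec he1 hμ0 z).deriv]
    have a1 := hslope μ hμI z hz
    have a2 := abs_intervalIntegral_mul_le (k := fun y => (K (z - y) - expAvg K μ (z - y)) / μ)
      (e := e) hL (fun y => (abs_deriv_expAvg_le hB hμ0 (z - y)).trans (hB₁ μ hμI)) he1
    have a3 := (abs_le.1 a2).2
    linarith [mul_comm L (2 * B / b)]
  -- Half of `η` pays for the change of speed, half for the integral over `[0, L]`.
  have hnear : ∀ z, |U z - expAvg (primitive K) μ₀ z| ≤ η := by
    intro z
    have a1 := abs_expAvg_sub_le hWc hWB (hK.abs_primitive_sub_le hB) μ μ₀ z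
    have a2 := abs_intervalIntegral_mul_le (k := fun y => expAvg K μ (z - y))
      (e := e) hL (fun y => abs_expAvg_le hB μ (z - y)) he1
    have a3 := hclose μ hμI
    rw [hU, profile]
    rw [abs_le] at *
    constructor <;> linarith [a1.1, a1.2, a2.1, a2.2]
  have hUl : ∀ z, z ≤ -r → U z < θ := fun z hz => by
    linarith [(abs_le.1 (hnear z)).2, hl z hz]
  have hUr : ∀ z, r ≤ z → θ + τ < U z := fun z hz => by
    linarith [(abs_le.1 (hnear z)).1, hr z hz]
  obtain ⟨hH1, hcr⟩ := hypothesisH1_of_slope hK hUd hθ0 hτ.le hθτ hL hLr h0 hUL hd hUl hUr hs1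
    hs3 hLs
  set f : ℝ → ℝ := fun y => S (U y - θ) with hf
  have hUc := hUd.continuous
  have hfc : Continuous f := by fun_prop
  have hf0 : ∀ y ≤ 0, f y = 0 := fun y hy => by
    refine hS0 _ (sub_nonpos.2 ?_)
    rcases hy.lt_or_eq with h | h
    · exact ((hcr y).1 h).le
    · rw [h, h0]
  have hf1 : ∀ y, L ≤ y → f y = 1 := fun y hy => by
    refine hS1 _ ?_
    rcases hy.lt_or_eq with h | h
    · linarith [(hcr y).2 h]
    · rw [← h]; linarith
  have hfC : ∀ y, |f y| ≤ 1 := fun y => by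
    rw [abs_of_nonneg (hSnn _)]; exact hSle _
  -- The crossings of `U` show that its true firing pattern is the prescribed one: equal to that of
  -- `v` on `[0, L]`, and `0` and `1` outside.
  have hsolves : SolvesFrontEq K S θ μ U := by
    refine ⟨hUd, fun z => ?_⟩
    rw [profile_eq hK hec he1 hμ0, hK.integral_mul_eq_primitive_sub hfc hL hf0 hf1]
    congr 1
    refine intervalIntegral.integral_congr fun y hy => ?_
    rw [uIcc_of_le hL] at hy
    simp only [he, hf, hUv y hy]
  have sT : ∀ s : ℝ, Tendsto (fun z : ℝ => f (z - s)) atTop (𝓝 1) := fun s =>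
    tendsto_const_nhds.congr' <| by
      filter_upwards [eventually_ge_atTop (L + s)] with z hz
      exact (hf1 _ (by linarith)).symm
  have sB : ∀ s : ℝ, Tendsto (fun z : ℝ => f (z - s)) atBot (𝓝 0) := fun s =>
    tendsto_const_nhds.congr' <| by
      filter_upwards [eventually_le_atBot s] with z hz
      exact (hf0 _ (by linarith)).symm
  have hlim := tendsto_profile hK hec he1 μ L
  obtain ⟨hc, l1, l2, l3, l4⟩ := hsolves.regularity hμ0 (fun _ => rfl)
    (hK.hasDerivAt_conv hfc hfC) (continuous_conv hK.integrable_deriv hfc hfC)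
    (by simpa using tendsto_conv hK.integrable hfc hfC sB)
    (by simpa [hK.integral_eq_one] using tendsto_conv hK.integrable hfc hfC sT)
    hlim.1 hlim.2
    (by simpa using tendsto_conv hK.integrable_deriv hfc hfC sB)
    (by simpa [hK.integral_deriv_eq_zero] using tendsto_conv hK.integrable_deriv hfc hfC sT)
  exact ⟨U, μ, hc, hμ0, hsolves, hsolves.comp_add_right, hsolves.solvesNeuralField, hH1,
    hlim.1, hlim.2, l1, l2, l3, l4⟩

theorem eventually_mul_lt_nhdsGT_zero (c : ℝ) {d : ℝ} (hd : 0 < d) :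
    ∀ᶠ τ in 𝓝[>] (0 : ℝ), c * τ < d := by
  have h : Tendsto (fun τ : ℝ => c * τ) (𝓝 0) (𝓝 (c * 0)) :=
    (continuous_const.mul continuous_id).tendsto 0
  rw [mul_zero] at h
  exact (h.eventually_lt_const hd).filter_mono nhdsWithin_le_nhds

theorem eventually_exists_isRegularFront {K : ℝ → ℝ} {M θ : ℝ} {S : ℝ → ℝ → ℝ} {U₀ : ℝ → ℝ}
    {μ₀ : ℝ} (hK : IsLateralInhibitionKernel K M) (hθ0 : 0 < θ) (hθ1 : θ < 1 / 2)
    (hS : IsSmoothHeavisideFamily S) (hU₀ : IsHeavisideFront K (S 0) θ U₀ μ₀) :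
    ∀ᶠ τ in 𝓝[>] (0 : ℝ), ∃ (U : ℝ → ℝ) (μ : ℝ), IsRegularFront K M θ τ (S τ) U μ := by
  have hUeq := hU₀.eq_expAvg hK hS.heaviside_neg hS.heaviside_pos
  have hμ₀ := hU₀.speed_pos
  obtain ⟨B, hB0, hB⟩ := hK.exists_bound
  have hWc := hK.continuous_primitive
  have hWB := hK.abs_primitive_le
  have hΦ0 : expAvg (primitive K) μ₀ 0 = θ := by rw [← hUeq]; exact hU₀.at_zero
  -- The slope of `U₀` at `0` is `4m`, so slopes stay above `2m` for nearby `μ` and `z`.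
  set m := (1 / 2 - θ) / (4 * μ₀) with hmdef
  have hm : 0 < m := div_pos (by linarith) (by linarith)
  have hΦc := continuous_expAvg hWc hWB
  obtain ⟨δ, hδ, hδm⟩ : ∃ δ > 0, ∀ μ z : ℝ, |μ - μ₀| < δ → |z| < δ →
      2 * m < (primitive K z - expAvg (primitive K) μ z) / μ := by
    have hc : ContinuousAt (fun q : ℝ × ℝ =>
        (primitive K q.2 - expAvg (primitive K) q.1 q.2) / q.1) (μ₀, 0) :=
      (((hWc.comp continuous_snd).sub hΦc).continuousAt).div continuousAt_fst hμ₀.ne'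
    have hlt : 2 * m < (primitive K 0 - expAvg (primitive K) μ₀ 0) / μ₀ := by
      rw [hK.primitive_zero, hΦ0, show (1 / 2 - θ) / μ₀ = 4 * m by rw [hmdef]; field_simp]
      linarith
    obtain ⟨δ, hδ, h⟩ := Metric.eventually_nhds_iff.1 (hc.eventually_const_lt hlt)
    refine ⟨δ, hδ, fun μ z h1 h2 => h (y := (μ, z)) ?_⟩
    rw [Prod.dist_eq, Real.dist_eq, Real.dist_eq, sub_zero]
    exact max_lt h1 h2
  set r := δ / 2 with hr
  have hr0 : 0 < r := by positivity
  have hU₀c : Continuous U₀ := hU₀.solves.1.continuous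
  obtain ⟨η₁, hη₁, hgap₁⟩ := hU₀c.exists_gap_of_tendsto_atTop (r := r) (c := θ) (ℓ := 1)
    (fun z hz => hU₀.above z (hr0.trans_le hz)) hU₀.lim_top (by linarith)
  -- The gap on the left, by the reflection `z ↦ -U₀ (-z)`.
  obtain ⟨η₂, hη₂, hgap₂⟩ := Continuous.exists_gap_of_tendsto_atTop (g := fun z => -U₀ (-z))
    (r := r) (c := -θ) (ℓ := -0) (by fun_prop)
    (fun z hz => neg_lt_neg (hU₀.below (-z) (by linarith)))
    (hU₀.lim_bot.comp tendsto_neg_atTop_atBot).neg (by linarith)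
  set η := min η₁ η₂ / 2 with hη
  have hη0 : 0 < η := by have := lt_min hη₁ hη₂; positivity
  have hηle₁ : 2 * η ≤ η₁ := by rw [hη]; linarith [min_le_left η₁ η₂]
  have hηle₂ : 2 * η ≤ η₂ := by rw [hη]; linarith [min_le_right η₁ η₂]
  -- The three bounds keep the speeds above `μ₀ / 2`, in the range of the slope estimate, and within
  -- uniform distance `η / 2` of `U₀`.
  obtain ⟨μ₁, μ₂, a1, a2, a3, a4, a5, a6⟩ :=
    (hK.hasDerivAt_expAvg_primitive_speed μ₀).exists_lt_gt_of_neg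
      (neg_lt_zero.2 (hK.integral_mul_exp_mul_pos hμ₀ (by rwa [hΦ0])))
      (show 0 < min (μ₀ / 2) (min δ (η / (2 * B))) by positivity)
  rw [hΦ0] at a5 a6
  have hδ' : ∀ μ ∈ Icc μ₁ μ₂, |μ - μ₀| < min (μ₀ / 2) (min δ (η / (2 * B))) := fun μ hμ => by
    rw [abs_lt]; constructor <;> linarith [hμ.1, hμ.2]
  obtain ⟨σ₁, hσ₁⟩ := hK.exists_isSigma1
  obtain ⟨s₀, hs₀, hs₀le⟩ := hK.exists_le_sigma3
  -- All constants are fixed before `τ`; each remaining condition is an upper bound on a multiple of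
  -- `τ`.
  filter_upwards [self_mem_nhdsWithin, eventually_mul_lt_nhdsGT_zero 1 (show 0 < 1 - θ by linarith),
    eventually_mul_lt_nhdsGT_zero (B / m) (sub_pos.2 a5),
    eventually_mul_lt_nhdsGT_zero (B / m) (sub_pos.2 a6),
    eventually_mul_lt_nhdsGT_zero (2 * B / (μ₀ / 2) / m) (show 0 < m / 4 by linarith),
    eventually_mul_lt_nhdsGT_zero (B / m) (show 0 < η / 2 by linarith),
    eventually_mul_lt_nhdsGT_zero (1 / m) hr0, eventually_mul_lt_nhdsGT_zero 1 hη0,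
    eventually_mul_lt_nhdsGT_zero (1 / m) (lt_min hσ₁.1 hs₀)] with τ hτ t1 t2 t3 t4 t5 t6 t7 t8
  have hτ0 : 0 < τ := hτ
  have eB : B / m * τ = B * (τ / m) := by ring
  have e1 : 1 / m * τ = τ / m := by ring
  rw [eB] at t2 t3 t5
  rw [e1] at t6 t8
  refine exists_isRegularFront (r := r) (η := η) (μ₀ := μ₀) (b := μ₀ / 2) (m := m)
    (s := min σ₁ s₀) hK hB hθ0.le hτ0 (by linarith) hm
    (hS.monotone hτ0) (hS.continuous τ hτ0) (hS.eq_zero τ hτ0) (hS.eq_one τ hτ0)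
    (hS.nonneg hτ0) (hS.le_one hτ0) (by linarith) ?_ (a2.trans a3).le ?_ ?_ ?_ ?_
    (by linarith) (by linarith) ?_ t5.le t6 (by linarith) ?_ ?_ t8.le
  · linarith [min_le_left (μ₀ / 2) (min δ (η / (2 * B)))]
  · intro μ hμ z hz
    refine (hδm μ z ((hδ' μ hμ).trans_le ((min_le_right _ _).trans (min_le_left _ _))) ?_).le
    exact (abs_le.2 hz).trans_lt (by rw [hr]; linarith)
  · intro μ hμ
    have h1 := ((hδ' μ hμ).trans_le ((min_le_right _ _).trans (min_le_right _ _))).le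
    rw [le_div_iff₀ (by positivity)] at h1
    linarith
  · intro z hz
    have := hgap₂ (-z) (by linarith)
    rw [neg_neg] at this
    rw [← hUeq]
    linarith
  · intro z hz
    rw [← hUeq]
    linarith [hgap₁ z hz]
  · rw [show τ / m * (2 * B / (μ₀ / 2)) = 2 * B / (μ₀ / 2) / m * τ by ring]
    exact t4.le
  · intro σ hσ
    rw [hσ₁.2.2 σ hσ.1 hσ.2.1]
    exact min_le_left _ _
  · intro v hv σ hσ
    exact (min_le_right _ _).trans (hs₀le v hv σ hσ)

theorem theorem1p2 (K : ℝ → ℝ) (M θ : ℝ) (S : ℝ → ℝ → ℝ) (U₀ : ℝ → ℝ) (μ₀ : ℝ)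
    (hK : IsLateralInhibitionKernel K M) (hθ_pos : 0 < θ) (hθ_lt : θ < 1 / 2)
    (hS : IsSmoothHeavisideFamily S) (hU₀ : IsHeavisideFront K (S 0) θ U₀ μ₀) :
    ∃ ε₀ : ℝ, 0 < ε₀ ∧ ∃ (U : ℝ → ℝ → ℝ) (μ : ℝ → ℝ), U 0 = U₀ ∧ μ 0 = μ₀ ∧
      ∀ τ : ℝ, 0 ≤ τ → τ < ε₀ →
        ContDiff ℝ 2 (U τ) ∧
        0 < μ τ ∧
        SolvesFrontEq K (S τ) θ (μ τ) (U τ) ∧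
        (∀ c : ℝ, SolvesFrontEq K (S τ) θ (μ τ) (fun z => U τ (z + c))) ∧
        SolvesNeuralField K (S τ) θ (fun x t => U τ (x + μ τ * t)) ∧
        HypothesisH1 K M θ τ (U τ) ∧
        Tendsto (U τ) atBot (𝓝 0) ∧
        Tendsto (U τ) atTop (𝓝 1) ∧
        Tendsto (deriv (U τ)) atBot (𝓝 0) ∧
        Tendsto (deriv (U τ)) atTop (𝓝 0) ∧
        Tendsto (iteratedDeriv 2 (U τ)) atBot (𝓝 0) ∧
        Tendsto (iteratedDeriv 2 (U τ)) atTop (𝓝 0) := by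
  classical
  obtain ⟨ε₀, hε₀, h⟩ := mem_nhdsGT_iff_exists_Ioo_subset.1
    (eventually_exists_isRegularFront hK hθ_pos hθ_lt hS hU₀)
  -- The conditions are stated as implications so that `choose` applies to every real `τ`; outside
  -- `[0, ε₀)` the pair is a dummy.
  have hex : ∀ τ : ℝ, ∃ (U : ℝ → ℝ) (μ : ℝ), (τ = 0 → U = U₀ ∧ μ = μ₀) ∧
      (0 ≤ τ → τ < ε₀ → IsRegularFront K M θ τ (S τ) U μ) := by
    intro τ
    by_cases h0 : τ = 0
    · subst h0
      exact ⟨U₀, μ₀, fun _ => ⟨rfl, rfl⟩, fun _ _ => hU₀.isRegularFront hK hθ_pos.le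
        (by linarith) hS.heaviside_neg hS.heaviside_pos⟩
    · by_cases hτ : 0 < τ ∧ τ < ε₀
      · obtain ⟨U, μ, hU⟩ := h hτ
        exact ⟨U, μ, fun h => absurd h h0, fun _ _ => hU⟩
      · exact ⟨U₀, μ₀, fun h => absurd h h0, fun h1 h2 =>
          absurd ⟨lt_of_le_of_ne h1 (Ne.symm h0), h2⟩ hτ⟩
  choose U μ hUμ using hex
  exact ⟨ε₀, hε₀, U, μ, ((hUμ 0).1 rfl).1, ((hUμ 0).1 rfl).2, fun τ h1 h2 => (hUμ τ).2 h1 h2⟩
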